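/- Let $n\ge 1$, let $-\frac1n<\alpha<0$, and let $\mu$ be a Borel probability measure on $\mathbb R^n$ with $\int|x|\,d\mu(x)<\infty$ and $\int x\,d\mu(x)=o$ whose support is not contained in any (affine) hyperplane. Then there exist a proper, convex, lower semicontinuous function $\varphi_0:\mathbb R^n\to\mathbb R\cup\{+\infty\}$ with $\varphi_0\ge\frac1\alpha$, and a Borel measure $\varrho_0^s$ on $\mathbb R^n$ that is singular to Lebesgue measure and concentrated on $\{\varphi_0=\frac1\alpha\}$, such that, with $\rho_0=(1-\alpha\varphi_0)^{1/\alpha}$ (equal to $+\infty$ where $\varphi_0=\frac1\alpha$ and to $0$ where $\varphi_0=+\infty$), the $\alpha$-concave measure $$\bar\varrho=\rho_0\,dx+\varrho_0^s$$ is finite, its absolutely continuous part $\rho_0\,dx$ is not zero, and the following hold. (i) $\mu$ is a Euclidean surface area measure of $\bar\varrho$: there is a Borel measure $\pi$ on $\mathbb R^n\times\mathbb R^n$ whose first marginal is $\rho_0^{1-\alpha}\,dx+\varrho_0^s$, whose second marginal is $\mu$, and whose support satisfies $$\mathrm{Supp}(\pi)\subset\mathrm{Graph}(\partial\varphi_0)=\{(x,y):\varphi_0(x)<+\infty,\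 \varphi_0(z)\ge\varphi_0(x)+\langle y,z-x\rangle\ \text{for all } z\in\mathbb R^n\}.$$ (ii) The spherical surface area measure of $\bar\varrho$ is the zero measure on $S^{n-1}$: $(\nu_K)_\sharp\big(\rho_0\,d\mathcal H^{n-1}|_{\partial K}\big)=0$, where $K$ is the closure of $\{\rho_0>0\}$, $\nu_K$ is its Gauss map (the outer unit normal, defined $\mathcal H^{n-1}$-almost everywhere on $\partial K$), and $\mathcal H^{n-1}$ is the $(n-1)$-dimensional Hausdorff measure. -/

import Mathlib

open MeasureTheory Set
open scoped ENNReal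

noncomputable section

/-- `Rn n` is `n`-dimensional Euclidean space. -/
abbrev Rn (n : ℕ) : Type := EuclideanSpace ℝ (Fin n)

/-- The unit sphere `S^{n-1}` of `n`-dimensional Euclidean space. -/
abbrev UnitSphere (n : ℕ) : Type := Metric.sphere (0 : Rn n) 1

/-! ### Convex functions with values in the extended reals -/

/-- The effective domain of `φ`. -/
def effDom {n : ℕ} (φ : Rn n → EReal) : Set (Rn n) := {x | φ x < ⊤}

/-- Proper, convex, lower semicontinuous functions with values in `ℝ ∪ {+∞}`.
The products use the convention `0 * ⊤ = 0`. -/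
structure IsConv {n : ℕ} (φ : Rn n → EReal) : Prop where
  ne_bot : ∀ x, φ x ≠ ⊥
  proper : (effDom φ).Nonempty
  convex : ∀ x y : Rn n, ∀ t ∈ Icc (0 : ℝ) 1,
    φ (t • x + (1 - t) • y) ≤ (t : EReal) * φ x + ((1 - t : ℝ) : EReal) * φ y
  lsc : LowerSemicontinuous φ

/-- The graph of the subgradient: all `(x, y)` with `x` in the effective domain and
`φ z ≥ φ x + ⟨y, z - x⟩` for every `z`. -/
def subgradGraph {n : ℕ} (φ : Rn n → EReal) : Set (Rn n × Rn n) :=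
  {p | p.1 ∈ effDom φ ∧ ∀ z : Rn n, φ p.1 + ((inner ℝ p.2 (z - p.1) : ℝ) : EReal) ≤ φ z}

/-- The function `(1 - α φ)^{1/α}` with values in `[0, ∞]`; for `α < 0` and `φ ≥ 1/α` it is
`∞` where `φ = 1/α` and `0` where `φ = +∞`. -/
def alphaDensity {n : ℕ} (α : ℝ) (φ : Rn n → EReal) (x : Rn n) : ℝ≥0∞ :=
  (1 - (α : EReal) * φ x).toENNReal ^ (1 / α)

/-! ### The Gauss map -/

/-- The outer unit normals of `K` at `x`. -/
def outerNormals {n : ℕ} (K : Set (Rn n)) (x : Rn n) : Set (UnitSphere n) :=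
  {u | ∀ y ∈ K, inner ℝ (u : Rn n) (y - x) ≤ 0}

/-- A fixed unit vector, the value of the Gauss map where the outer unit normal is not unique. -/
def defaultDir (n : ℕ) [NeZero n] : UnitSphere n :=
  ⟨EuclideanSpace.single 0 1, by simp⟩

open Classical in
/-- The Gauss map of `K`: the outer unit normal at every `x` where it exists and is unique. For a
closed convex set with interior points this is the case at almost every boundary point with respect
to the `(n-1)`-dimensional Hausdorff measure; elsewhere the map has a constant value. -/
def gaussMap {n : ℕ} [NeZero n] (K : Set (Rn n)) (x : Rn n) : UnitSphere n :=
  if h : ∃! u, u ∈ outerNormals K x then h.choose else defaultDir n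

/-! ### Measures -/

/-- An `α`-concave measure `ρ dx + ϱˢ` with `ρ = (1 - α φ)^{1/α}`, where `φ ≥ 1/α` is proper, convex
and lower semicontinuous, and `ϱˢ` is singular to Lebesgue measure and concentrated on
`{φ = 1/α}`. -/
structure AlphaConcaveMeasure (n : ℕ) (α : ℝ) where
  /-- the base function -/
  base : Rn n → EReal
  /-- the singular part -/
  sing : Measure (Rn n)
  isConv_base : IsConv base
  le_base : ∀ x, ((1 / α : ℝ) : EReal) ≤ base x
  mutuallySingular : sing ⟂ₘ (volume : Measure (Rn n))
  sing_concentrated : sing {x | base x ≠ ((1 / α : ℝ) : EReal)} = 0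

namespace AlphaConcaveMeasure

variable {n : ℕ} {α : ℝ}

/-- The density `ρ = (1 - α φ)^{1/α}` of the absolutely continuous part. -/
def density (r : AlphaConcaveMeasure n α) : Rn n → ℝ≥0∞ := alphaDensity α r.base

/-- The measure `ρ dx + ϱˢ`. -/
def toMeasure (r : AlphaConcaveMeasure n α) : Measure (Rn n) :=
  volume.withDensity r.density + r.sing

/-- The measure `ρ^{1-α} dx + ϱˢ`. -/
def weighted (r : AlphaConcaveMeasure n α) : Measure (Rn n) :=
  volume.withDensity (fun x => r.density x ^ (1 - α)) + r.sing

/-- `μ` is a Euclidean surface area measure of `ρ dx + ϱˢ`: some measure `π` with marginals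
`ρ^{1-α} dx + ϱˢ` and `μ` has its support in the graph of the subgradient of `φ`. -/
def IsEuclideanSurfaceAreaMeasure (r : AlphaConcaveMeasure n α) (μ : Measure (Rn n)) : Prop :=
  ∃ π : Measure (Rn n × Rn n),
    π.map Prod.fst = r.weighted ∧ π.map Prod.snd = μ ∧ π.support ⊆ subgradGraph r.base

/-- The support `K_ρ` of the density, a closed convex set. -/
def supp (r : AlphaConcaveMeasure n α) : Set (Rn n) := closure {x | r.density x ≠ 0}

/-- The spherical surface area measure: the push-forward under the Gauss map of `K_ρ` of the measure
with density `ρ` with respect to `(n-1)`-dimensional Hausdorff measure on the boundary of `K_ρ`. -/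
def sphericalSurfaceAreaMeasure [NeZero n] (r : AlphaConcaveMeasure n α) :
    Measure (UnitSphere n) :=
  (((Measure.euclideanHausdorffMeasure (n - 1) : Measure (Rn n)).restrict
    (frontier r.supp)).withDensity r.density).map (gaussMap r.supp)

end AlphaConcaveMeasure

/-! ### Measurability of the Gauss map, so that the push-forward is the intended one -/

theorem isClosed_outerNormals_graph {n : ℕ} (K : Set (Rn n)) :
    IsClosed {p : Rn n × UnitSphere n | p.2 ∈ outerNormals K p.1} := by
  have h : {p : Rn n × UnitSphere n | p.2 ∈ outerNormals K p.1} =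
      ⋂ y ∈ K, {p : Rn n × UnitSphere n | inner ℝ (p.2 : Rn n) (y - p.1) ≤ 0} := by
    ext p; simp [outerNormals]
  rw [h]
  refine isClosed_biInter fun y _ => isClosed_le ?_ continuous_const
  fun_prop

theorem isClosed_outerNormals_meets {n : ℕ} (K : Set (Rn n)) {C : Set (UnitSphere n)}
    (hC : IsClosed C) : IsClosed {x : Rn n | ∃ u ∈ C, u ∈ outerNormals K x} := by
  have h := isClosedMap_fst_of_compactSpace (X := Rn n) (Y := UnitSphere n) _
    ((isClosed_outerNormals_graph K).inter (hC.preimage continuous_snd))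
  convert h using 1
  ext x
  simp [and_comm]

theorem measurableSet_unique_outerNormal {n : ℕ} (K : Set (Rn n)) :
    MeasurableSet {x : Rn n | ∃! u, u ∈ outerNormals K x} := by
  have hM : ∀ k : ℕ, IsClosed {x : Rn n | ∃ u v : UnitSphere n,
      u ∈ outerNormals K x ∧ v ∈ outerNormals K x ∧ 1 / ((k : ℝ) + 1) ≤ dist u v} := by
    intro k
    have c1 : IsClosed {p : Rn n × (UnitSphere n × UnitSphere n) |
        p.2.1 ∈ outerNormals K p.1} :=
      (isClosed_outerNormals_graph K).preimage
        (f := fun p : Rn n × (UnitSphere n × UnitSphere n) => (p.1, p.2.1)) (by fun_prop)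
    have c2 : IsClosed {p : Rn n × (UnitSphere n × UnitSphere n) |
        p.2.2 ∈ outerNormals K p.1} :=
      (isClosed_outerNormals_graph K).preimage
        (f := fun p : Rn n × (UnitSphere n × UnitSphere n) => (p.1, p.2.2)) (by fun_prop)
    have c3 : IsClosed {p : Rn n × (UnitSphere n × UnitSphere n) |
        1 / ((k : ℝ) + 1) ≤ dist p.2.1 p.2.2} :=
      isClosed_le continuous_const (by fun_prop)
    have h := isClosedMap_fst_of_compactSpace (X := Rn n)
      (Y := UnitSphere n × UnitSphere n) _ (c1.inter (c2.inter c3))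
    convert h using 1
    ext x
    simp
  have hU : IsClosed {x : Rn n | ∃ u ∈ (univ : Set (UnitSphere n)), u ∈ outerNormals K x} :=
    isClosed_outerNormals_meets K isClosed_univ
  convert hU.measurableSet.diff (MeasurableSet.iUnion fun k => (hM k).measurableSet) using 1
  ext x
  simp only [mem_ofPred_eq, mem_sdiff, mem_univ, true_and, mem_iUnion, not_exists]
  constructor
  · rintro ⟨u, hu, huniq⟩
    refine ⟨⟨u, hu⟩, ?_⟩
    rintro k v w ⟨hv, hw, hd⟩
    rw [huniq v hv, huniq w hw, dist_self] at hd
    have : 0 < 1 / ((k : ℝ) + 1) := by positivity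
    linarith
  · rintro ⟨⟨u, hu⟩, h⟩
    refine ⟨u, hu, fun v hv => ?_⟩
    by_contra hne
    obtain ⟨k, hk⟩ := exists_nat_one_div_lt (dist_pos.2 hne)
    exact h k v u ⟨hv, hu, hk.le⟩

theorem measurable_gaussMap {n : ℕ} [NeZero n] (K : Set (Rn n)) : Measurable (gaussMap K) := by
  refine measurable_of_isClosed fun C hC => ?_
  have hR := measurableSet_unique_outerNormal K
  have hP := (isClosed_outerNormals_meets K hC).measurableSet
  have h : gaussMap K ⁻¹' C =
      ({x : Rn n | ∃! u, u ∈ outerNormals K x} ∩ {x : Rn n | ∃ u ∈ C, u ∈ outerNormals K x}) ∪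
      ({x : Rn n | ∃! u, u ∈ outerNormals K x}ᶜ ∩ {_x : Rn n | defaultDir n ∈ C}) := by
    ext x
    simp only [mem_preimage, mem_union, mem_inter_iff, mem_ofPred_eq, mem_compl_iff]
    by_cases hx : ∃! u, u ∈ outerNormals K x
    · have e : gaussMap K x = hx.choose := by simp only [gaussMap, dif_pos hx]
      rw [e]
      have h1 : hx.choose ∈ outerNormals K x := hx.choose_spec.1
      constructor
      · exact fun hc => Or.inl ⟨hx, _, hc, h1⟩
      · rintro (⟨_, u, hu, hn⟩ | ⟨hn, _⟩)
        · rwa [← hx.unique hn h1]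
        · exact absurd hx hn
    · have e : gaussMap K x = defaultDir n := by simp only [gaussMap, dif_neg hx]
      rw [e]
      tauto
  rw [h]
  exact (hR.inter hP).union (hR.compl.inter (MeasurableSet.const _))

end

open Filter Topology

/-! ### Suprema of affine functions -/

/-! Put `β = -1/α`, so that `β > n`. The potential comes from a variational problem dual to optimal
transport: among integrable `ψ` with `∫ ψ dμ ≤ -1`, maximize `∫ f ^ (-β)`, where `f` is the positive
part of the Legendre conjugate of `ψ`, taken over a set `S` of full measure. Centering of `μ` makes
the problem invariant under translations of `f` and gives `f ≥ 1`.

Existence (`exists_maximizer`): since `μ` is not carried by a hyperplane, competitors whose value is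
bounded below are, after translation, bounded at the origin and grow linearly with uniform constants
(`exists_uniform_bounds`). Since `β > n`, this gives an integrable majorant of `f ^ (-β)`.
Epigraphical compactness and Fatou's lemma then yield a maximizer.

Euler-Lagrange (`first_variation`, `le_mass`, `map_gradSup_eq`): replacing `ψ` by `ψ + t h` with `h
≥ 0` lowers `f` at rate at least `h (∇f)`. The constraint is restored by homogeneity, and letting `t
→ 0` gives `(∇f)_# (f ^ (-β - 1) dx) ≤ C μ`. A constant perturbation of the other sign shows that
the masses agree, hence so do the measures. As `ρ ^ (1 - α)` has exponent `-β (1 - α) = -β - 1` in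
`f`, a dilation normalizing the constant makes `μ` a Euclidean surface area measure, with zero
singular part.

Boundary (`liminf_outside_eq_zero`, `hausdorffMeasure_frontier_domain_eq_zero`): for `h = ‖·‖` the
perturbed function is finite also within distance `t` of the domain of `f`, which adds a term to the
first variation. The Euler-Lagrange equation already saturates the inequality, so this term is
`o(t)` along a subsequence. Hence boundary points where `f` is finite have outer neighbourhoods of
volume `o(t)`, and a covering argument shows that they are `H^{n-1}`-null. So `ρ = 0` almost
everywhere on the boundary. -/

/-- The supremum over `y ∈ S` of the positive parts of the affine functions `x ↦ ⟨x, y⟩ - ψ y`. -/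
noncomputable def supAffine {n : ℕ} (ψ : Rn n → ℝ) (S : Set (Rn n)) (x : Rn n) : ℝ≥0∞ :=
  ⨆ y ∈ S, ENNReal.ofReal (inner ℝ x y - ψ y)

/-- The integral of `f ^ (-β)`. -/
noncomputable def negPowInt {n : ℕ} (β : ℝ) (f : Rn n → ℝ≥0∞) : ℝ≥0∞ := ∫⁻ x, f x ^ (-β)

/-- The competitors of the variational problem: `ψ` is integrable with integral at most `-1`, and
`S` has full measure. -/
structure Admissible {n : ℕ} (μ : Measure (Rn n)) (ψ : Rn n → ℝ) (S : Set (Rn n)) : Prop where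
  integrable : Integrable ψ μ
  integral_le : ∫ y, ψ y ∂μ ≤ -1
  ae_mem : ∀ᵐ y ∂μ, y ∈ S

theorem rpow_neg_anti {β : ℝ} (hβ : 0 ≤ β) : Antitone fun a : ℝ≥0∞ => a ^ (-β) := by
  intro a b h
  simp only [ENNReal.rpow_neg]
  exact ENNReal.inv_le_inv.2 (ENNReal.rpow_le_rpow h hβ)

section supAffine

variable {n : ℕ} {ψ : Rn n → ℝ} {S : Set (Rn n)}

theorem ofReal_le_supAffine (ψ : Rn n → ℝ) {y : Rn n} (hy : y ∈ S) (x : Rn n) :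
    ENNReal.ofReal (inner ℝ x y - ψ y) ≤ supAffine ψ S x :=
  le_iSup₂ (f := fun y (_ : y ∈ S) => ENNReal.ofReal (inner ℝ x y - ψ y)) y hy

theorem supAffine_le_iff {x : Rn n} {a : ℝ≥0∞} :
    supAffine ψ S x ≤ a ↔ ∀ y ∈ S, ENNReal.ofReal (inner ℝ x y - ψ y) ≤ a := iSup₂_le_iff

theorem lowerSemicontinuous_supAffine : LowerSemicontinuous (supAffine ψ S) := by
  refine lowerSemicontinuous_biSup fun y _ => Continuous.lowerSemicontinuous ?_
  exact ENNReal.continuous_ofReal.comp (by fun_prop)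

theorem measurable_supAffine : Measurable (supAffine ψ S) :=
  lowerSemicontinuous_supAffine.measurable

theorem sub_le_toReal_supAffine {x y : Rn n} (hx : supAffine ψ S x ≠ ⊤) (hy : y ∈ S) :
    inner ℝ x y - ψ y ≤ (supAffine ψ S x).toReal :=
  (ENNReal.ofReal_le_iff_le_toReal hx).1 (ofReal_le_supAffine ψ hy x)

theorem supAffine_mono_set {T : Set (Rn n)} (h : S ⊆ T) (x : Rn n) :
    supAffine ψ S x ≤ supAffine ψ T x :=
  biSup_mono h

theorem negPowInt_anti {β : ℝ} (hβ : 0 ≤ β) {f g : Rn n → ℝ≥0∞} (h : ∀ x, f x ≤ g x) :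
    negPowInt β g ≤ negPowInt β f :=
  lintegral_mono fun x => rpow_neg_anti hβ (h x)

end supAffine

/-! ### Consequences of centering and of not lying in a hyperplane. -/

section Moments

variable {n : ℕ} {μ : Measure (Rn n)}

theorem integrable_id_of_norm (hmoment : Integrable (fun x : Rn n => ‖x‖) μ) :
    Integrable (fun x : Rn n => x) μ :=
  (integrable_norm_iff aestronglyMeasurable_id).1 hmoment

theorem integral_inner_eq_zero (hmoment : Integrable (fun x : Rn n => ‖x‖) μ)
    (hbary : ∫ x, x ∂μ = 0) (x : Rn n) : ∫ y, inner ℝ x y ∂μ = 0 := by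
  rw [integral_inner (integrable_id_of_norm hmoment), hbary, inner_zero_right]

theorem integrable_inner_left (hmoment : Integrable (fun x : Rn n => ‖x‖) μ) (x : Rn n) :
    Integrable (fun y => inner ℝ x y) μ :=
  (integrable_id_of_norm hmoment).const_inner x

/-- A measure that is not carried by a hyperplane has first absolute moments bounded below. -/
theorem exists_le_integral_abs_inner (hmoment : Integrable (fun x : Rn n => ‖x‖) μ)
    (hplane : ∀ (v : Rn n) (c : ℝ), v ≠ 0 → ¬ μ.support ⊆ {x : Rn n | inner ℝ v x = c}) :
    ∃ c : ℝ, 0 < c ∧ ∀ x : Rn n, c * ‖x‖ ≤ ∫ y, |inner ℝ x y| ∂μ := by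
  set g : Rn n → ℝ := fun x => ∫ y, |inner ℝ x y| ∂μ with hg
  have hint : ∀ x, Integrable (fun y => |inner ℝ x y|) μ := fun x =>
    (integrable_inner_left hmoment x).abs
  have hcont : Continuous g := by
    have : LipschitzWith (Real.toNNReal (∫ y, ‖y‖ ∂μ)) g := by
      refine LipschitzWith.of_dist_le_mul fun x x' => ?_
      rw [Real.dist_eq, hg]
      simp only
      rw [← integral_sub (hint x) (hint x'), Real.coe_toNNReal _ (by positivity),
        ← integral_mul_const]
      refine (abs_integral_le_integral_abs).trans
        (integral_mono ((hint x).sub (hint x')).abs (hmoment.mul_const _) fun y => ?_)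
      refine (abs_abs_sub_abs_le _ _).trans ?_
      rw [← inner_sub_left, dist_eq_norm, mul_comm]
      exact abs_real_inner_le_norm _ _
    exact this.continuous
  have hpos : ∀ x, x ≠ 0 → 0 < g x := by
    intro x hx
    refine lt_of_le_of_ne (integral_nonneg fun y => abs_nonneg _) fun h => ?_
    have h0 := (integral_eq_zero_iff_of_nonneg (fun y => abs_nonneg _) (hint x)).1 h.symm
    refine hplane x 0 hx (Measure.support_subset_of_isClosed
      (isClosed_eq (by fun_prop) continuous_const) ?_)
    filter_upwards [h0] with y hy
    simpa using hy
  rcases (Metric.sphere (0 : Rn n) 1).eq_empty_or_nonempty with he | hne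
  · refine ⟨1, one_pos, fun x => ?_⟩
    have : x = 0 := by
      by_contra hx
      have : (‖x‖⁻¹ • x) ∈ Metric.sphere (0 : Rn n) 1 := by
        simp [norm_smul, hx]
      rw [he] at this
      exact this
    simp [this]
  -- The constant is the minimum over the unit sphere; homogeneity extends the bound to all `x`.
  · obtain ⟨v, hv, hmin⟩ := (isCompact_sphere (0 : Rn n) 1).exists_isMinOn hne hcont.continuousOn
    refine ⟨g v, hpos v ?_, fun x => ?_⟩
    · rintro rfl; simp at hv
    · rcases eq_or_ne x 0 with rfl | hx
      · simp
      have h1 : g v ≤ g (‖x‖⁻¹ • x) := hmin (by simp [norm_smul, hx])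
      have h2 : g (‖x‖⁻¹ • x) = ‖x‖⁻¹ * g x := by
        simp only [hg, inner_smul_left, abs_mul, integral_const_mul]
        simp
      rw [h2] at h1
      have hn : 0 < ‖x‖ := norm_pos_iff.2 hx
      calc g v * ‖x‖ ≤ ‖x‖⁻¹ * g x * ‖x‖ := by gcongr
        _ = g x := by field_simp

variable [IsProbabilityMeasure μ] {ψ : Rn n → ℝ} {S : Set (Rn n)}

/-- Integrate `⟨x, y⟩ - ψ y ≤ f x` against `μ`; the linear term vanishes because `μ` is centered. -/
theorem neg_integral_le_supAffine (hmoment : Integrable (fun x : Rn n => ‖x‖) μ)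
    (hbary : ∫ x, x ∂μ = 0) (hi : Integrable ψ μ) (hS : ∀ᵐ y ∂μ, y ∈ S) (x : Rn n) :
    ENNReal.ofReal (-∫ y, ψ y ∂μ) ≤ supAffine ψ S x := by
  rcases eq_or_ne (supAffine ψ S x) ⊤ with h | h
  · simp [h]
  rw [ENNReal.ofReal_le_iff_le_toReal h]
  have h1 : ∫ y, (inner ℝ x y - ψ y) ∂μ ≤ ∫ _, (supAffine ψ S x).toReal ∂μ := by
    refine integral_mono_ae ((integrable_inner_left hmoment x).sub hi) (integrable_const _) ?_
    filter_upwards [hS] with y hy using sub_le_toReal_supAffine h hy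
  rw [integral_sub (integrable_inner_left hmoment x) hi,
    integral_inner_eq_zero hmoment hbary] at h1
  simpa using h1

theorem Admissible.one_le (hmoment : Integrable (fun x : Rn n => ‖x‖) μ)
    (hbary : ∫ x, x ∂μ = 0) (h : Admissible μ ψ S) (x : Rn n) : 1 ≤ supAffine ψ S x := by
  refine le_trans ?_ (neg_integral_le_supAffine hmoment hbary h.integrable h.ae_mem x)
  rw [← ENNReal.ofReal_one]
  exact ENNReal.ofReal_le_ofReal (by linarith [h.integral_le])

/-- A competitor whose value at the origin is at most twice a lower bound grows linearly. -/
theorem Admissible.coercive (hmoment : Integrable (fun x : Rn n => ‖x‖) μ)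
    (hbary : ∫ x, x ∂μ = 0) (h : Admissible μ ψ S) {c m : ℝ}
    (hc : ∀ x : Rn n, c * ‖x‖ ≤ ∫ y, |inner ℝ x y| ∂μ)
    (h0 : supAffine ψ S 0 ≤ ENNReal.ofReal (2 * m)) (hm : 1 ≤ m)
    (hle : ∀ x, ENNReal.ofReal m ≤ supAffine ψ S x) (x : Rn n) :
    ENNReal.ofReal ((m + c / 4 * ‖x‖) / 2) ≤ supAffine ψ S x := by
  rcases eq_or_ne (supAffine ψ S x) ⊤ with hx | hx
  · simp [hx]
  rw [ENNReal.ofReal_le_iff_le_toReal hx]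
  set F := (supAffine ψ S x).toReal
  have hF : m ≤ F := (ENNReal.ofReal_le_iff_le_toReal hx).1 (hle x)
  have hψ : ∀ y ∈ S, 0 ≤ ψ y + 2 * m := by
    intro y hy
    have := (ofReal_le_supAffine ψ hy 0).trans h0
    rw [ENNReal.ofReal_le_ofReal_iff (by linarith), inner_zero_left] at this
    linarith
  have hi := integrable_inner_left hmoment x
  -- Pointwise, `⟨x, y⟩ ≤ (F - 2m) + (ψ y + 2m)` and the last bracket is nonnegative, which bounds
  -- the positive part of `⟨x, y⟩`. By centering, that positive part integrates to half of `∫ |⟨x,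
  -- y⟩|`.
  have h1 : ∫ y, (inner ℝ x y + |inner ℝ x y|) / 2 ∂μ
      ≤ ∫ y, (max (F - 2 * m) 0 + (ψ y + 2 * m)) ∂μ := by
    refine integral_mono_ae ((hi.add hi.abs).div_const 2)
      ((integrable_const _).add (h.integrable.add (integrable_const _))) ?_
    filter_upwards [h.ae_mem] with y hy
    have h2 := sub_le_toReal_supAffine hx hy
    have h3 := hψ y hy
    have h4 := le_max_left (F - 2 * m) 0
    have h5 := le_max_right (F - 2 * m) 0
    rcases abs_cases (inner ℝ x y) with ⟨e, _⟩ | ⟨e, _⟩ <;> simp only [e] <;> linarith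
  rw [integral_div, integral_add hi hi.abs, integral_inner_eq_zero hmoment hbary,
    integral_add (f := fun _ => max (F - 2 * m) 0) (g := fun y => ψ y + 2 * m)
      (integrable_const _) (h.integrable.add (integrable_const _)),
    integral_add h.integrable (integrable_const _)] at h1
  simp only [integral_const, probReal_univ, one_smul, zero_add] at h1
  have h6 := hc x
  have h7 := h.integral_le
  -- If `F ≥ 2m`, then `F ≥ 1 + c‖x‖/2`, to be averaged with `F ≥ m`. If `F < 2m`, then `c‖x‖/4 ≤ m
  -- - 1/2`, so `F ≥ m` suffices; this case dictates the factor `1/4`.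
  rcases max_cases (F - 2 * m) 0 with ⟨e, _⟩ | ⟨e, _⟩ <;> rw [e] at h1 <;> linarith

end Moments

/-! ### Uniform bounds modulo translation. -/

section Bounds

variable {n : ℕ}

theorem lintegral_linear_rpow_neg_lt_top {c p : ℝ} (hc : 0 < c) (hp : (n : ℝ) < p) :
    ∫⁻ x : Rn n, ENNReal.ofReal ((1 + c * ‖x‖) / 2) ^ (-p) < ⊤ := by
  have hint : Integrable (fun x : Rn n => (1 + ‖x‖) ^ (-p)) :=
    integrable_one_add_norm (by simpa using hp)
  have hp0 : 0 ≤ p := (Nat.cast_nonneg n).trans hp.le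
  set d := min 1 c / 2 with hd
  have hd0 : 0 < d := by positivity
  refine lt_of_le_of_lt (b := ∫⁻ x : Rn n, ENNReal.ofReal (d ^ (-p) * (1 + ‖x‖) ^ (-p))) ?_
    (hint.const_mul _).lintegral_lt_top
  refine lintegral_mono fun x => ?_
  have h1 : d * (1 + ‖x‖) ≤ (1 + c * ‖x‖) / 2 := by
    have := min_le_left 1 c
    have := mul_le_mul_of_nonneg_right (min_le_right 1 c) (norm_nonneg x)
    rw [hd]; linarith
  refine (rpow_neg_anti hp0 (ENNReal.ofReal_le_ofReal h1)).trans ?_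
  simp only
  rw [ENNReal.ofReal_rpow_of_pos (by positivity), Real.mul_rpow hd0.le (by positivity)]

theorem supAffine_sub_inner (ψ : Rn n → ℝ) (S : Set (Rn n)) (x₀ x : Rn n) :
    supAffine (fun y => ψ y - inner ℝ x₀ y) S x = supAffine ψ S (x + x₀) := by
  simp only [supAffine, inner_add_left]
  congr! 4
  ring_nf

theorem negPowInt_sub_inner (β : ℝ) (ψ : Rn n → ℝ) (S : Set (Rn n)) (x₀ : Rn n) :
    negPowInt β (supAffine (fun y => ψ y - inner ℝ x₀ y) S) = negPowInt β (supAffine ψ S) := by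
  simp only [negPowInt, supAffine_sub_inner]
  exact lintegral_add_right_eq_self (fun x => supAffine ψ S x ^ (-β)) x₀

variable {μ : Measure (Rn n)} {ψ : Rn n → ℝ} {S : Set (Rn n)}

theorem Admissible.sub_inner (hmoment : Integrable (fun x : Rn n => ‖x‖) μ)
    (hbary : ∫ x, x ∂μ = 0) (h : Admissible μ ψ S) (x₀ : Rn n) :
    Admissible μ (fun y => ψ y - inner ℝ x₀ y) S where
  integrable := h.integrable.sub (integrable_inner_left hmoment x₀)
  integral_le := by
    rw [integral_sub h.integrable (integrable_inner_left hmoment x₀),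
      integral_inner_eq_zero hmoment hbary, sub_zero]
    exact h.integral_le
  ae_mem := h.ae_mem

variable [IsProbabilityMeasure μ]

/-- Subtracting `⟨x₀, ·⟩` from `ψ` translates `f` by `x₀` and preserves both the constraint and the
functional. Take `x₀` with `f x₀` below twice the infimum `m` of `f`. -/
theorem Admissible.exists_normalized (hmoment : Integrable (fun x : Rn n => ‖x‖) μ)
    (hbary : ∫ x, x ∂μ = 0) (h : Admissible μ ψ S) {β : ℝ} (hβ : 0 < β)
    (hJ : negPowInt β (supAffine ψ S) ≠ 0) :
    ∃ ψ' : Rn n → ℝ, Admissible μ ψ' S ∧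
      negPowInt β (supAffine ψ' S) = negPowInt β (supAffine ψ S) ∧
      ∃ m : ℝ, 1 ≤ m ∧ supAffine ψ' S 0 ≤ ENNReal.ofReal (2 * m) ∧
        ∀ x, ENNReal.ofReal m ≤ supAffine ψ' S x := by
  set a := ⨅ x, supAffine ψ S x with ha
  have h1 : 1 ≤ a := le_iInf (h.one_le hmoment hbary)
  have htop : a ≠ ⊤ := by
    intro htop
    refine hJ ?_
    have : ∀ x, supAffine ψ S x = ⊤ := fun x => top_le_iff.1 (htop ▸ iInf_le _ x)
    simp [negPowInt, this, hβ]
  obtain ⟨x₀, hx₀⟩ : ∃ x, supAffine ψ S x < 2 * a := by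
    refine iInf_lt_iff.1 (?_ : a < 2 * a)
    rw [two_mul]
    exact ENNReal.lt_add_right htop (by positivity)
  refine ⟨_, h.sub_inner hmoment hbary x₀, negPowInt_sub_inner _ _ _ _, a.toReal, ?_, ?_, ?_⟩
  · rw [← ENNReal.toReal_one]
    exact ENNReal.toReal_mono htop h1
  · rw [supAffine_sub_inner, zero_add, ENNReal.ofReal_mul (by norm_num), ENNReal.ofReal_toReal htop]
    simpa using hx₀.le
  · intro x
    rw [supAffine_sub_inner, ENNReal.ofReal_toReal htop]
    exact iInf_le _ _

/-- Up to a translation, competitors whose value is bounded below are bounded at the origin and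
grow linearly, both with uniform constants. -/
theorem exists_uniform_bounds (hmoment : Integrable (fun x : Rn n => ‖x‖) μ)
    (hbary : ∫ x, x ∂μ = 0)
    (hplane : ∀ (v : Rn n) (c : ℝ), v ≠ 0 → ¬ μ.support ⊆ {x : Rn n | inner ℝ v x = c})
    {β : ℝ} (hβ : (n : ℝ) < β) {δ : ℝ≥0∞} (hδ : δ ≠ 0) :
    ∃ c M : ℝ, 0 < c ∧ ∀ ψ S, Admissible μ ψ S → δ ≤ negPowInt β (supAffine ψ S) →
      ∃ ψ' : Rn n → ℝ, Admissible μ ψ' S ∧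
        negPowInt β (supAffine ψ' S) = negPowInt β (supAffine ψ S) ∧
        supAffine ψ' S 0 ≤ ENNReal.ofReal M ∧
        ∀ x, ENNReal.ofReal ((1 + c * ‖x‖) / 2) ≤ supAffine ψ' S x := by
  obtain ⟨c, hc0, hc⟩ := exists_le_integral_abs_inner hmoment hplane
  have hβ0 : 0 < β := (Nat.cast_nonneg n).trans_lt hβ
  -- Half of the excess `β - n` is spent on extracting the factor `(m / 2) ^ (-s)`, and `β - s > n`
  -- still makes the rest integrable. A lower bound on the functional thus bounds `m / 2`, and `f 0
  -- ≤ 2m` is four times that.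
  set s := (β - n) / 2 with hs
  have hs0 : 0 < s := by rw [hs]; linarith
  set A := ∫⁻ x : Rn n, ENNReal.ofReal ((1 + c / 4 * ‖x‖) / 2) ^ (-(β - s)) with hA
  have hAtop : A < ⊤ := lintegral_linear_rpow_neg_lt_top (by positivity) (by rw [hs]; linarith)
  refine ⟨c / 4, 4 * ((A / δ) ^ (1 / s)).toReal, by positivity, fun ψ S h hJ => ?_⟩
  obtain ⟨ψ', h', hJ', m, hm, hm0, hmle⟩ := h.exists_normalized hmoment hbary hβ0
    (fun e => hδ (le_zero_iff.1 (e ▸ hJ)))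
  have hco := h'.coercive hmoment hbary hc hm0 hm hmle
  refine ⟨ψ', h', hJ', hm0.trans (ENNReal.ofReal_le_ofReal ?_), fun x => le_trans ?_ (hco x)⟩
  · have key : negPowInt β (supAffine ψ' S) ≤ ENNReal.ofReal (m / 2) ^ (-s) * A := by
      rw [hA, ← lintegral_const_mul' _ _ (by
        rw [ENNReal.ofReal_rpow_of_pos (by positivity)]; exact ENNReal.ofReal_ne_top)]
      refine lintegral_mono fun x => ?_
      refine (rpow_neg_anti hβ0.le (hco x)).trans ?_
      have hx := norm_nonneg x
      have e : -β = -s + -(β - s) := by ring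
      simp only
      rw [e, ENNReal.rpow_add _ _ (by simp; positivity) ENNReal.ofReal_ne_top]
      gcongr ?_ * ?_
      · exact rpow_neg_anti hs0.le (ENNReal.ofReal_le_ofReal (by nlinarith))
      · exact rpow_neg_anti (by have : (0:ℝ) ≤ n := Nat.cast_nonneg n
                                rw [hs]; linarith) (ENNReal.ofReal_le_ofReal (by nlinarith))
    have h1 : ENNReal.ofReal (m / 2) ^ s ≤ A / δ := by
      have h2 := (hJ.trans hJ'.ge).trans key
      rw [ENNReal.rpow_neg, mul_comm, ← div_eq_mul_inv] at h2
      rw [ENNReal.le_div_iff_mul_le (Or.inl hδ) (Or.inr hAtop.ne)]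
      rwa [ENNReal.le_div_iff_mul_le (Or.inl _) (Or.inl _), mul_comm] at h2
      · rw [ENNReal.ofReal_rpow_of_pos (by positivity)]
        simp; positivity
      · rw [ENNReal.ofReal_rpow_of_pos (by positivity)]; exact ENNReal.ofReal_ne_top
    have h3 : ENNReal.ofReal (m / 2) ≤ (A / δ) ^ (1 / s) := by
      have := ENNReal.rpow_le_rpow h1 (one_div_pos.2 hs0).le
      rwa [← ENNReal.rpow_mul, mul_one_div_cancel hs0.ne', ENNReal.rpow_one] at this
    have h4 : (A / δ) ^ (1 / s) ≠ ⊤ :=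
      ENNReal.rpow_ne_top_of_nonneg (by positivity) (ENNReal.div_ne_top hAtop.ne hδ)
    have := (ENNReal.ofReal_le_iff_le_toReal h4).1 h3
    linarith
  · exact ENNReal.ofReal_le_ofReal (by linarith)

theorem exists_admissible_negPowInt_ne_zero (hmoment : Integrable (fun x : Rn n => ‖x‖) μ)
    {β : ℝ} (hβ : 0 < β) :
    ∃ ψ : Rn n → ℝ, ∃ S, Admissible μ ψ S ∧ negPowInt β (supAffine ψ S) ≠ 0 := by
  set M := ∫ y, ‖y‖ ∂μ with hM
  -- With this `ψ` the supremum is at most `M + 1` on the unit ball, which has positive volume.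
  refine ⟨fun y => ‖y‖ - (M + 1), univ, ⟨hmoment.sub (integrable_const _), ?_, by simp⟩, ?_⟩
  · rw [integral_sub hmoment (integrable_const _)]; simp [hM]
  · have hM0 : 0 ≤ M := by positivity
    have h1 : ∀ x ∈ Metric.ball (0 : Rn n) 1,
        supAffine (fun y => ‖y‖ - (M + 1)) univ x ≤ ENNReal.ofReal (M + 1) := by
      intro x hx
      refine supAffine_le_iff.2 fun y _ => ENNReal.ofReal_le_ofReal ?_
      have h2 := real_inner_le_norm x y
      have h3 : ‖x‖ < 1 := by simpa using hx
      nlinarith [norm_nonneg y]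
    have h4 : ∫⁻ x in Metric.ball (0 : Rn n) 1, ENNReal.ofReal (M + 1) ^ (-β)
        ≤ negPowInt β (supAffine (fun y : Rn n => ‖y‖ - (M + 1)) univ) := by
      refine le_trans ?_ (setLIntegral_le_lintegral (Metric.ball (0 : Rn n) 1) _)
      exact setLIntegral_mono_ae' measurableSet_ball
        (Eventually.of_forall fun x hx => rpow_neg_anti hβ.le (h1 x hx))
    intro h5
    rw [h5, setLIntegral_const, ENNReal.ofReal_rpow_of_pos (by positivity)] at h4
    have h6 := Metric.measure_ball_pos (volume : Measure (Rn n)) 0 one_pos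
    have h7 : 0 < ENNReal.ofReal ((M + 1) ^ (-β)) := by
      rw [ENNReal.ofReal_pos]; positivity
    exact absurd h4 (not_le.2 (ENNReal.mul_pos h7.ne' h6.ne'))

end Bounds

/-! ### Compactness and existence of a maximizer. -/

/-- Sequential compactness of functions with values in `[0, ∞]` for epigraphical convergence. -/
theorem exists_subseq_epi_limit {X : Type*} [TopologicalSpace X] [SecondCountableTopology X]
    (g : ℕ → X → ℝ≥0∞) :
    ∃ φ : ℕ → ℕ, StrictMono φ ∧ ∃ f : X → ℝ≥0∞,
      (∀ x, f x ≤ liminf (fun k => g (φ k) x) atTop) ∧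
      ∀ x t, f x < t → ∀ V ∈ 𝓝 x, ∀ᶠ k in atTop, ∃ z ∈ V, g (φ k) z < t := by
  set B := TopologicalSpace.countableBasis X
  have hB := TopologicalSpace.isBasis_countableBasis X
  have : Countable B := (TopologicalSpace.countable_countableBasis X).to_subtype
  -- The infima over the sets of a countable basis form a point of a countable product of copies of
  -- `[0, ∞]`, which is sequentially compact. The limit function at `x` is the supremum of the
  -- limits over basic sets containing `x`.
  obtain ⟨L, φ, hφ, hL⟩ := CompactSpace.tendsto_subseq
    (fun k => (fun U : B => ⨅ x ∈ (U : Set X), g k x : B → ℝ≥0∞))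
  rw [tendsto_pi_nhds] at hL
  refine ⟨φ, hφ, fun x => ⨆ (U : B) (_ : x ∈ (U : Set X)), L U, fun x => ?_, fun x t ht V hV => ?_⟩
  · refine iSup₂_le fun U hU => ?_
    rw [← (hL U).liminf_eq]
    exact liminf_le_liminf (Eventually.of_forall fun k => iInf₂_le x hU)
  · obtain ⟨U, hUB, hxU, hUV⟩ := hB.mem_nhds_iff.1 hV
    have h1 : L ⟨U, hUB⟩ < t := lt_of_le_of_lt
      (le_iSup₂ (f := fun (U : B) (_ : x ∈ (U : Set X)) => L U) ⟨U, hUB⟩ hxU) ht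
    filter_upwards [(hL ⟨U, hUB⟩).eventually_lt_const h1] with k hk
    simp only [Function.comp, iInf_lt_iff] at hk
    obtain ⟨z, hz, h⟩ := hk
    exact ⟨z, hUV hz, h⟩

section Existence

variable {n : ℕ} {μ : Measure (Rn n)} [IsProbabilityMeasure μ]

/-- A sequence of competitors, bounded at the origin, has a subsequence whose epigraphical limit
dominates the function of a competitor. -/
theorem exists_admissible_le {ψ : ℕ → Rn n → ℝ} {S : Set (Rn n)}
    (h : ∀ k, Admissible μ (ψ k) S) {M : ℝ} (h0 : ∀ k, supAffine (ψ k) S 0 ≤ ENNReal.ofReal M)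
    {f : Rn n → ℝ≥0∞} (hf : ∀ x t, f x < t → ∀ V ∈ 𝓝 x, ∀ᶠ k in atTop,
      ∃ z ∈ V, supAffine (ψ k) S z < t) :
    ∃ ψ' S', Admissible μ ψ' S' ∧ ∀ x, supAffine ψ' S' x ≤ f x := by
  set N := max M 0 with hN
  have hN0 : 0 ≤ N := le_max_right _ _
  have hψ : ∀ k, ∀ y ∈ S, 0 ≤ ψ k y + N := by
    intro k y hy
    have := (ofReal_le_supAffine (ψ k) hy 0).trans
      ((h0 k).trans (ENNReal.ofReal_le_ofReal (le_max_left M 0)))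
    rw [ENNReal.ofReal_le_ofReal_iff hN0, inner_zero_left] at this
    linarith
  -- The bound at the origin gives `ψ k ≥ -N` on `S`. After the shift by `N`, Fatou's lemma bounds
  -- the integral of the lower limit; shifting back gives the new competitor, on the set where this
  -- limit is finite.
  set ℓ : Rn n → ℝ≥0∞ := fun y => liminf (fun k => ENNReal.ofReal (ψ k y + N)) atTop with hℓ
  have hmeas : ∀ k, AEMeasurable (fun y => ENNReal.ofReal (ψ k y + N)) μ := fun k =>
    ((h k).integrable.aemeasurable.add_const N).ennreal_ofReal
  have hℓm : AEMeasurable ℓ μ := by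
    choose! g hg hge using fun k => hmeas k
    refine ⟨fun y => liminf (fun k => g k y) atTop, Measurable.liminf hg, ?_⟩
    filter_upwards [ae_all_iff.2 hge] with y hy
    simp only [hℓ, hy]
  have hint : ∀ k, ∫⁻ y, ENNReal.ofReal (ψ k y + N) ∂μ ≤ ENNReal.ofReal (N - 1) := by
    intro k
    rw [← ofReal_integral_eq_lintegral_ofReal (f := fun y => ψ k y + N) ((h k).integrable.add (integrable_const _))
      (by filter_upwards [(h k).ae_mem] with y hy using hψ k y hy)]
    refine ENNReal.ofReal_le_ofReal ?_
    rw [integral_add (h k).integrable (integrable_const _)]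
    have := (h k).integral_le
    simp; linarith
  have hℓint : ∫⁻ y, ℓ y ∂μ ≤ ENNReal.ofReal (N - 1) := by
    refine (lintegral_liminf_le' hmeas).trans ?_
    refine (liminf_le_liminf (Eventually.of_forall hint)).trans ?_
    simp
  have hN1 : 1 ≤ N := by
    have h1 := integral_mono_ae (integrable_const 0) ((h 0).integrable.add (integrable_const N))
      (by filter_upwards [(h 0).ae_mem] with y hy using hψ 0 y hy)
    simp only [Pi.add_apply] at h1
    rw [integral_add (h 0).integrable (integrable_const _)] at h1
    have := (h 0).integral_le
    simp at h1
    linarith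
  have hℓtop : ∫⁻ y, ℓ y ∂μ ≠ ⊤ := ne_top_of_le_ne_top ENNReal.ofReal_ne_top hℓint
  have hℓfin : ∀ᵐ y ∂μ, ℓ y < ⊤ := ae_lt_top' hℓm hℓtop
  refine ⟨fun y => (ℓ y).toReal - N, S ∩ {y | ℓ y < ⊤}, ⟨?_, ?_, ?_⟩, fun x => ?_⟩
  · exact (integrable_toReal_of_lintegral_ne_top hℓm hℓtop).sub (integrable_const _)
  · rw [integral_sub (integrable_toReal_of_lintegral_ne_top hℓm hℓtop) (integrable_const _),
      integral_toReal hℓm hℓfin]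
    have := ENNReal.toReal_mono ENNReal.ofReal_ne_top hℓint
    rw [ENNReal.toReal_ofReal (by linarith)] at this
    simp; linarith
  · filter_upwards [(h 0).ae_mem, hℓfin] with y h1 h2 using ⟨h1, h2⟩
  · refine supAffine_le_iff.2 fun y hy => ?_
    rcases eq_or_ne (f x) ⊤ with hx | hx
    · simp [hx]
    rw [ENNReal.ofReal_le_iff_le_toReal hx]
    refine le_of_forall_pos_le_add fun ε hε => ?_
    set t : ℝ := (f x).toReal + ε / 2 with ht
    have hft : f x < ENNReal.ofReal t := by
      rw [ENNReal.lt_ofReal_iff_toReal_lt hx]; linarith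
    -- The radius is such that replacing `x` by a point at distance less than `r` costs at most `ε /
    -- 2` in `⟨x, y⟩`.
    set r : ℝ := ε / 2 / (‖y‖ + 1) with hr
    have hr0 : 0 < r := by positivity
    have hrε : r * ‖y‖ ≤ ε / 2 := by
      rw [hr, div_mul_eq_mul_div, div_le_iff₀ (by positivity)]
      nlinarith [norm_nonneg y]
    have key : ENNReal.ofReal (inner ℝ x y - r * ‖y‖ - t + N) ≤ ℓ y := by
      refine le_liminf_of_le (by isBoundedDefault) ?_
      filter_upwards [hf x _ hft _ (Metric.ball_mem_nhds x hr0)] with k hk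
      obtain ⟨z, hz, hzt⟩ := hk
      refine ENNReal.ofReal_le_ofReal ?_
      have h1 := (sub_le_toReal_supAffine hzt.ne_top hy.1).trans_lt
        ((ENNReal.lt_ofReal_iff_toReal_lt hzt.ne_top).1 hzt)
      have h2 : inner ℝ (x - z) y ≤ r * ‖y‖ := by
        refine (real_inner_le_norm _ _).trans ?_
        gcongr
        rw [← dist_eq_norm, dist_comm]
        exact (Metric.mem_ball.1 hz).le
      rw [inner_sub_left] at h2
      linarith
    have h3 := (ENNReal.ofReal_le_iff_le_toReal hy.2.ne).1 key
    linarith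

theorem exists_maximizer (hmoment : Integrable (fun x : Rn n => ‖x‖) μ)
    (hbary : ∫ x, x ∂μ = 0)
    (hplane : ∀ (v : Rn n) (c : ℝ), v ≠ 0 → ¬ μ.support ⊆ {x : Rn n | inner ℝ v x = c})
    {β : ℝ} (hβ : (n : ℝ) < β) :
    ∃ ψ : Rn n → ℝ, ∃ S, Admissible μ ψ S ∧
      (∀ ψ' S', Admissible μ ψ' S' →
        negPowInt β (supAffine ψ' S') ≤ negPowInt β (supAffine ψ S)) ∧
      negPowInt β (supAffine ψ S) ≠ 0 ∧ negPowInt β (supAffine ψ S) ≠ ⊤ := by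
  have hβ0 : 0 < β := (Nat.cast_nonneg n).trans_lt hβ
  obtain ⟨ψ₀, S₀, hadm, hδ⟩ := exists_admissible_negPowInt_ne_zero hmoment hβ0
  set δ := negPowInt β (supAffine ψ₀ S₀) with hδdef
  obtain ⟨c, M, hc, hbd⟩ := exists_uniform_bounds hmoment hbary hplane hβ hδ
  set A := ∫⁻ x : Rn n, ENNReal.ofReal ((1 + c * ‖x‖) / 2) ^ (-β) with hA
  have hAtop : A < ⊤ := lintegral_linear_rpow_neg_lt_top hc hβ
  -- Only values at least `δ` are kept, since the uniform bounds need a positive lower bound.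
  set V := {v | ∃ ψ S, Admissible μ ψ S ∧ v = negPowInt β (supAffine ψ S) ∧ δ ≤ v} with hV
  have hVne : V.Nonempty := ⟨δ, ψ₀, S₀, hadm, rfl, le_rfl⟩
  obtain ⟨u, -, hu, huV⟩ := exists_seq_tendsto_sSup hVne (OrderTop.bddAbove V)
  choose ψ S hψ huψ hδu using huV
  -- A countable intersection provides one full-measure set for the whole sequence; shrinking `S`
  -- lowers `f` and so can only raise the functional.
  have hT : ∀ k, Admissible μ (ψ k) (⋂ j, S j) := fun k =>
    ⟨(hψ k).integrable, (hψ k).integral_le, by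
      filter_upwards [ae_all_iff.2 fun j => (hψ j).ae_mem] with y hy using mem_iInter.2 hy⟩
  have huT : ∀ k, u k ≤ negPowInt β (supAffine (ψ k) (⋂ j, S j)) := fun k => by
    rw [huψ k]
    exact negPowInt_anti hβ0.le (supAffine_mono_set (iInter_subset _ _))
  choose ψ' hψ' heq h0 hlow using fun k => hbd _ _ (hT k) ((hδu k).trans (huT k))
  obtain ⟨φ, hφ, f, hf1, hf2⟩ := exists_subseq_epi_limit fun k => supAffine (ψ' k) (⋂ j, S j)
  obtain ⟨ψ₁, S₁, h₁, hle⟩ := exists_admissible_le (fun k => hψ' (φ k)) (fun k => h0 (φ k)) hf2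
  have hsup : sSup V ≤ negPowInt β (supAffine ψ₁ S₁) := by
    -- Reverse Fatou, with the majorant supplied by the uniform linear growth.
    have h1 : limsup (fun k => negPowInt β (supAffine (ψ' (φ k)) (⋂ j, S j))) atTop
        ≤ ∫⁻ x, limsup (fun k => supAffine (ψ' (φ k)) (⋂ j, S j) x ^ (-β)) atTop :=
      limsup_lintegral_le _ (fun k => measurable_supAffine.pow_const _)
        (fun k => Eventually.of_forall fun x => rpow_neg_anti hβ0.le (hlow (φ k) x)) hAtop.ne
    have h2 : sSup V ≤ limsup (fun k => negPowInt β (supAffine (ψ' (φ k)) (⋂ j, S j))) atTop := by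
      rw [← (hu.comp hφ.tendsto_atTop).limsup_eq]
      refine limsup_le_limsup (Eventually.of_forall fun k => ?_)
      simp only [Function.comp, heq]
      exact huT _
    refine h2.trans (h1.trans (lintegral_mono fun x => ?_))
    refine (Antitone.map_liminf_of_continuousAt (rpow_neg_anti hβ0.le)
      (fun k => supAffine (ψ' (φ k)) (⋂ j, S j) x)
      ENNReal.continuous_rpow_const.continuousAt).symm.le.trans ?_
    exact rpow_neg_anti hβ0.le ((hle x).trans (hf1 x))
  have hδ1 : δ ≤ negPowInt β (supAffine ψ₁ S₁) :=
    (le_sSup (show δ ∈ V from ⟨ψ₀, S₀, hadm, rfl, le_rfl⟩)).trans hsup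
  refine ⟨ψ₁, S₁, h₁, fun ψ' S' h' => ?_, fun e => hδ (le_zero_iff.1 (e ▸ hδ1)), ?_⟩
  · rcases le_total δ (negPowInt β (supAffine ψ' S')) with h | h
    · exact (le_sSup (show _ ∈ V from ⟨ψ', S', h', rfl, h⟩)).trans hsup
    · exact h.trans hδ1
  · obtain ⟨ψ₂, -, he, -, hl⟩ := hbd _ _ h₁ hδ1
    rw [← he]
    exact ((lintegral_mono fun x => rpow_neg_anti hβ0.le (hl x)).trans_lt hAtop).ne

end Existence

/-! ### Homogeneity of the functional. -/

section Scaling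

variable {n : ℕ}

theorem lintegral_comp_smul_pos {r : ℝ} (hr : 0 < r) {g : Rn n → ℝ≥0∞} (hg : Measurable g) :
    ∫⁻ x, g (r • x) = ENNReal.ofReal (r ^ n)⁻¹ * ∫⁻ x, g x := by
  rw [← lintegral_map (μ := volume) hg (measurable_const_smul r),
    Measure.map_addHaar_smul volume hr.ne', lintegral_smul_measure]
  simp [abs_of_pos hr]

theorem ofReal_mul_rpow_neg {c β : ℝ} (hc : 0 < c) (hβ : 0 ≤ β) (b : ℝ≥0∞) :
    (ENNReal.ofReal c * b) ^ (-β) = ENNReal.ofReal (c ^ (-β)) * b ^ (-β) := by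
  rw [← ENNReal.ofReal_rpow_of_pos hc]
  simp only [ENNReal.rpow_neg]
  rw [ENNReal.mul_rpow_of_nonneg _ _ hβ, ENNReal.mul_inv]
  · rw [ENNReal.ofReal_rpow_of_pos hc]
    exact Or.inl (by simpa using Real.rpow_pos_of_pos hc β)
  · rw [ENNReal.ofReal_rpow_of_pos hc]
    exact Or.inl ENNReal.ofReal_ne_top

theorem supAffine_div {a : ℝ} (ha : 0 < a) (ψ : Rn n → ℝ) (S : Set (Rn n)) (x : Rn n) :
    supAffine (fun y => ψ y / a) S x = ENNReal.ofReal a⁻¹ * supAffine ψ S (a • x) := by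
  simp only [supAffine, ENNReal.mul_iSup]
  congr! 4 with y
  rw [← ENNReal.ofReal_mul (by positivity), inner_smul_left]
  congr 1
  simp only [conj_trivial]
  field_simp

variable {μ : Measure (Rn n)} {ψ : Rn n → ℝ} {S : Set (Rn n)}

/-- The value of a function with negative integral is controlled by the maximum over all
competitors, by homogeneity. -/
theorem negPowInt_mul_le {β : ℝ} (hβ : 0 ≤ β) {J : ℝ≥0∞}
    (hmax : ∀ ψ' S', Admissible μ ψ' S' → negPowInt β (supAffine ψ' S') ≤ J)
    (hi : Integrable ψ μ) (hS : ∀ᵐ y ∂μ, y ∈ S) {a : ℝ} (ha : 0 < a) (hint : ∫ y, ψ y ∂μ = -a) :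
    negPowInt β (supAffine ψ S) * ENNReal.ofReal (a ^ (β - n)) ≤ J := by
  have hadm : Admissible μ (fun y => ψ y / a) S :=
    ⟨hi.div_const a, by rw [integral_div, hint, neg_div, div_self ha.ne'], hS⟩
  refine le_trans (le_of_eq ?_) (hmax _ _ hadm)
  simp only [negPowInt, supAffine_div ha]
  have h1 : ∀ x, (ENNReal.ofReal a⁻¹ * supAffine ψ S (a • x)) ^ (-β)
      = ENNReal.ofReal (a ^ β) * supAffine ψ S (a • x) ^ (-β) := by
    intro x
    rw [ofReal_mul_rpow_neg (by positivity) hβ, Real.inv_rpow ha.le, Real.rpow_neg ha.le, inv_inv]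
  simp only [h1]
  rw [lintegral_const_mul' _ _ ENNReal.ofReal_ne_top,
    lintegral_comp_smul_pos ha (g := fun x => supAffine ψ S x ^ (-β))
      (measurable_supAffine.pow_const _), ← mul_assoc, ← ENNReal.ofReal_mul (by positivity),
    mul_comm, Real.rpow_sub ha, Real.rpow_natCast, div_eq_mul_inv]

/-- If the integral were `-a` with `a > 1`, rescaling to integral `-1` would multiply the finite
nonzero maximum by `a ^ (β - n) > 1`. -/
theorem integral_eq_of_maximizer {β : ℝ} (hβ : (n : ℝ) < β)
    (hmax : ∀ ψ' S', Admissible μ ψ' S' →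
      negPowInt β (supAffine ψ' S') ≤ negPowInt β (supAffine ψ S))
    (h : Admissible μ ψ S) (h0 : negPowInt β (supAffine ψ S) ≠ 0)
    (htop : negPowInt β (supAffine ψ S) ≠ ⊤) : ∫ y, ψ y ∂μ = -1 := by
  refine le_antisymm h.integral_le ?_
  by_contra! hlt
  have h1 := negPowInt_mul_le ((Nat.cast_nonneg n).trans hβ.le) hmax h.integrable h.ae_mem (a := -∫ y, ψ y ∂μ)
    (by linarith) (by ring)
  have h2 : 1 < (-∫ y, ψ y ∂μ) ^ (β - n) := Real.one_lt_rpow (by linarith) (by linarith)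
  refine absurd h1 (not_le.2 ?_)
  conv_lhs => rw [← mul_one (negPowInt β (supAffine ψ S))]
  exact ENNReal.mul_lt_mul_right h0 htop (by simpa using h2)

end Scaling

/-! ### Tangent inequalities for `a ↦ a ^ (-β)`. -/

section Tangent

/-- The graph of the convex function `a ↦ a ^ (-β)` lies above its tangent at `b`; here from `log u
≤ u - 1` and `1 + v ≤ exp v`. -/
theorem real_tangent {β a b : ℝ} (hβ : 0 < β) (ha : 0 < a) (hb : 0 < b) :
    b ^ (-β) + β * b ^ (-β - 1) * (b - a) ≤ a ^ (-β) := by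
  have h1 : 1 - β * (a / b - 1) ≤ (a / b) ^ (-β) := by
    rw [Real.rpow_def_of_pos (by positivity)]
    have h2 := Real.add_one_le_exp (Real.log (a / b) * -β)
    have h3 := mul_le_mul_of_nonneg_left
      (Real.log_le_sub_one_of_pos (show 0 < a / b by positivity)) hβ.le
    linarith
  rw [Real.div_rpow ha.le hb.le, le_div_iff₀ (by positivity)] at h1
  refine le_trans (le_of_eq ?_) h1
  rw [Real.rpow_sub_one hb.ne']
  field_simp
  ring

theorem rpow_neg_add_le {β : ℝ} (hβ : 0 < β) {a b : ℝ≥0∞} (hab : a ≤ b) :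
    b ^ (-β) + ENNReal.ofReal β * (b ^ (-β - 1) * (b - a)) ≤ a ^ (-β) := by
  rcases eq_or_ne b ⊤ with rfl | hb
  · simp [ENNReal.top_rpow_of_neg, hβ, show -β - 1 < 0 by linarith]
  rcases eq_or_ne a 0 with rfl | ha
  · simp [ENNReal.zero_rpow_of_neg, hβ]
  have ha' : a ≠ ⊤ := ne_top_of_le_ne_top hb hab
  have hb' : b ≠ 0 := fun h => ha (le_zero_iff.1 (h ▸ hab))
  lift a to NNReal using ha'
  lift b to NNReal using hb
  have ha0 : 0 < (a : ℝ) := by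
    rw [NNReal.coe_pos]; exact pos_iff_ne_zero.2 (by exact_mod_cast ha)
  have hb0 : 0 < (b : ℝ) := by
    rw [NNReal.coe_pos]; exact pos_iff_ne_zero.2 (by exact_mod_cast hb')
  have hab' : (a : ℝ) ≤ b := by exact_mod_cast hab
  rw [← ENNReal.ofReal_coe_nnreal, ← ENNReal.ofReal_coe_nnreal, ENNReal.ofReal_rpow_of_pos ha0,
    ENNReal.ofReal_rpow_of_pos hb0, ENNReal.ofReal_rpow_of_pos hb0,
    ← ENNReal.ofReal_sub _ ha0.le, ← ENNReal.ofReal_mul (by positivity),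
    ← ENNReal.ofReal_mul hβ.le, ← ENNReal.ofReal_add (by positivity)
      (mul_nonneg hβ.le (mul_nonneg (by positivity) (by linarith)))]
  refine ENNReal.ofReal_le_ofReal ?_
  rw [← mul_assoc]
  exact real_tangent hβ ha0 hb0

theorem rpow_neg_le_add {β t : ℝ} (hβ : 0 < β) (ht : 0 ≤ t) {b : ℝ≥0∞} (hb0 : b ≠ 0) :
    b ^ (-β) ≤ (b + ENNReal.ofReal t) ^ (-β)
      + ENNReal.ofReal (β * t) * b ^ (-β - 1) := by
  rcases eq_or_ne b ⊤ with rfl | hb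
  · simp [ENNReal.top_rpow_of_neg, hβ]
  lift b to NNReal using hb
  have hb0 : 0 < (b : ℝ) := by
    rw [NNReal.coe_pos]; exact pos_iff_ne_zero.2 (by exact_mod_cast hb0)
  rw [← ENNReal.ofReal_coe_nnreal, ← ENNReal.ofReal_add hb0.le ht,
    ENNReal.ofReal_rpow_of_pos hb0, ENNReal.ofReal_rpow_of_pos hb0,
    ENNReal.ofReal_rpow_of_pos (by positivity), ← ENNReal.ofReal_mul (by positivity),
    ← ENNReal.ofReal_add (by positivity) (by positivity)]
  refine ENNReal.ofReal_le_ofReal ?_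
  have := real_tangent hβ (show 0 < (b : ℝ) + t by positivity) hb0
  linarith

end Tangent

/-! ### Differentiability of the supremum and its envelope derivative. -/

section Convexity

variable {n : ℕ} {ψ : Rn n → ℝ} {S : Set (Rn n)}

theorem supAffine_convex {a b : ℝ} (ha : 0 ≤ a) (hb : 0 ≤ b) (hab : a + b = 1) (x z : Rn n) :
    supAffine ψ S (a • x + b • z)
      ≤ ENNReal.ofReal a * supAffine ψ S x + ENNReal.ofReal b * supAffine ψ S z := by
  refine supAffine_le_iff.2 fun y hy => ?_
  have e : inner ℝ (a • x + b • z) y - ψ y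
      = a * (inner ℝ x y - ψ y) + b * (inner ℝ z y - ψ y) := by
    rw [inner_add_left, inner_smul_left, inner_smul_left]
    simp only [conj_trivial]
    linear_combination (-ψ y) * hab.symm
  rw [e]
  refine ENNReal.ofReal_add_le.trans ?_
  rw [ENNReal.ofReal_mul ha, ENNReal.ofReal_mul hb]
  gcongr <;> exact ofReal_le_supAffine ψ hy _

theorem convexOn_toReal_supAffine :
    ConvexOn ℝ {x | supAffine ψ S x < ⊤} fun x => (supAffine ψ S x).toReal := by
  have key : ∀ ⦃x⦄, supAffine ψ S x < ⊤ → ∀ ⦃z⦄, supAffine ψ S z < ⊤ → ∀ ⦃a b : ℝ⦄, 0 ≤ a → 0 ≤ b →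
      ENNReal.ofReal a * supAffine ψ S x + ENNReal.ofReal b * supAffine ψ S z < ⊤ :=
    fun x hx z hz a b _ _ => ENNReal.add_lt_top.2
      ⟨ENNReal.mul_lt_top ENNReal.ofReal_lt_top hx, ENNReal.mul_lt_top ENNReal.ofReal_lt_top hz⟩
  refine ⟨fun x hx z hz a b ha hb hab => (supAffine_convex ha hb hab x z).trans_lt
    (key hx hz ha hb), fun x hx z hz a b ha hb hab => ?_⟩
  have h1 := ENNReal.toReal_mono (key hx hz ha hb).ne (supAffine_convex ha hb hab x z)
  rw [ENNReal.toReal_add (ENNReal.mul_lt_top ENNReal.ofReal_lt_top hx).ne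
    (ENNReal.mul_lt_top ENNReal.ofReal_lt_top hz).ne] at h1
  simpa [ENNReal.toReal_mul, ENNReal.toReal_ofReal, ha, hb] using h1

/-- Convex functions are locally Lipschitz in the interior, so Rademacher's theorem applies locally.
-/
theorem ConvexOn.ae_differentiableAt {D : Set (Rn n)} {F : Rn n → ℝ} (hF : ConvexOn ℝ D F) :
    ∀ᵐ x : Rn n, x ∈ interior D → DifferentiableAt ℝ F x := by
  have hL := hF.locallyLipschitzOn_interior
  refine measure_null_of_locally_null _ fun x hx => ?_
  simp only [mem_compl_iff, mem_ofPred_eq, Classical.not_imp] at hx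
  obtain ⟨K, t, ht, hlip⟩ := hL hx.1
  rw [nhdsWithin_eq_nhds.2 (isOpen_interior.mem_nhds hx.1)] at ht
  obtain ⟨U, hUt, hU, hxU⟩ := mem_nhds_iff.1 ht
  refine ⟨_, inter_mem_nhdsWithin _ (hU.mem_nhds hxU), ?_⟩
  refine measure_mono_null (fun z hz => ?_) ((hlip.mono hUt).ae_differentiableWithinAt_of_mem
    (μ := volume))
  simp only [mem_inter_iff, mem_compl_iff, mem_ofPred_eq, Classical.not_imp] at hz ⊢
  exact ⟨hz.2, fun h => hz.1.2 (h.differentiableAt (hU.mem_nhds hz.2))⟩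

theorem ae_top_or_differentiableAt (ψ : Rn n → ℝ) (S : Set (Rn n)) :
    ∀ᵐ x : Rn n, supAffine ψ S x = ⊤ ∨ (x ∈ interior {x | supAffine ψ S x < ⊤} ∧
      DifferentiableAt ℝ (fun x => (supAffine ψ S x).toReal) x) := by
  have hc := convexOn_toReal_supAffine (ψ := ψ) (S := S)
  have h1 : ∀ᵐ x : Rn n, x ∉ frontier {x | supAffine ψ S x < ⊤} :=
    measure_eq_zero_iff_ae_notMem.1 (hc.1.addHaar_frontier volume)
  filter_upwards [h1, ConvexOn.ae_differentiableAt hc] with x hx hd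
  by_cases h : supAffine ψ S x = ⊤
  · exact Or.inl h
  · have : x ∈ interior {x | supAffine ψ S x < ⊤} := by
      by_contra hi
      exact hx ⟨subset_closure (lt_top_iff_ne_top.2 h), hi⟩
    exact Or.inr ⟨this, hd this⟩

/-- Near a point of differentiability, approximate subgradients are close to the gradient. -/
theorem exists_forall_norm_sub_gradient_le {x : Rn n}
    (hx : x ∈ interior {x | supAffine ψ S x < ⊤})
    (hd : DifferentiableAt ℝ (fun x => (supAffine ψ S x).toReal) x) {ε : ℝ} (hε : 0 < ε) :
    ∃ δ : ℝ, 0 < δ ∧ ∀ y ∈ S, (supAffine ψ S x).toReal - δ ≤ inner ℝ x y - ψ y →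
      ‖y - gradient (fun x => (supAffine ψ S x).toReal) x‖ ≤ ε := by
  set F := fun x => (supAffine ψ S x).toReal with hF
  set p := gradient F x with hp
  have hg : HasGradientAt F p x := hd.hasGradientAt
  have hlit := (hasGradientAt_iff_isLittleO_nhds_zero.1 hg).def (half_pos hε)
  have hin : ∀ᶠ v in 𝓝 (0 : Rn n), supAffine ψ S (x + v) < ⊤ := by
    have : Tendsto (fun v => x + v) (𝓝 0) (𝓝 x) := by
      simpa using (continuous_const_add x).tendsto (0 : Rn n)
    exact this.eventually (mem_interior_iff_mem_nhds.1 hx)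
  obtain ⟨r, hr, hball⟩ := Metric.eventually_nhds_iff.1 (hlit.and hin)
  refine ⟨ε * (r / 2) / 2, by positivity, fun y hy h => ?_⟩
  by_contra! hlt
  have hne : 0 < ‖y - p‖ := hε.trans hlt
  -- Test at `x + v`, with `v` of length `r / 2` along `y - p`: the affine function of `y` gives a
  -- lower bound and differentiability an upper one. Together they give `(r / 2) ‖y - p‖ ≤ δ + ε r /
  -- 4`, and the chosen `δ` is `ε r / 4`.
  set v := (r / 2 / ‖y - p‖) • (y - p) with hv
  have hvn : ‖v‖ = r / 2 := by
    rw [hv, norm_smul, Real.norm_of_nonneg (by positivity)]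
    field_simp
  obtain ⟨h1, h2⟩ := hball (y := v) (by rw [dist_zero_right, hvn]; linarith)
  have h3 := sub_le_toReal_supAffine h2.ne hy
  rw [hvn] at h1
  have h4 := (abs_le.1 (Real.norm_eq_abs _ ▸ h1)).2
  rw [inner_add_left] at h3
  have h5 : inner ℝ v y - inner ℝ p v = r / 2 * ‖y - p‖ := by
    rw [real_inner_comm, ← inner_sub_left, hv, inner_smul_right, real_inner_self_eq_norm_sq]
    field_simp
  simp only [hF] at h4
  nlinarith

/-- The bound `1 ≤ f x` ensures that the truncation at zero does not hide the affine functions. -/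
theorem exists_mem_sub_le {x : Rn n} (hx : supAffine ψ S x ≠ ⊤) (h0 : 1 ≤ supAffine ψ S x)
    {δ : ℝ} (hδ : 0 < δ) : ∃ y ∈ S, (supAffine ψ S x).toReal - δ ≤ inner ℝ x y - ψ y := by
  by_contra! h
  have h1 : supAffine ψ S x ≤ ENNReal.ofReal ((supAffine ψ S x).toReal - δ) :=
    supAffine_le_iff.2 fun y hy => ENNReal.ofReal_le_ofReal (h y hy).le
  have h3 : 1 ≤ (supAffine ψ S x).toReal := by
    rw [← ENNReal.toReal_one]; exact ENNReal.toReal_mono hx h0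
  have h2 := ENNReal.toReal_mono ENNReal.ofReal_ne_top h1
  rw [ENNReal.toReal_ofReal'] at h2
  rcases max_cases ((supAffine ψ S x).toReal - δ) 0 with h | h <;> linarith

/-- Affine functions nearly attaining the supremum at `x` have slopes close to the gradient and lie
below `f`; passing to the limit gives the subgradient inequality. -/
theorem supAffine_ge_gradient {x : Rn n} (h0 : 1 ≤ supAffine ψ S x)
    (hx : x ∈ interior {x | supAffine ψ S x < ⊤})
    (hd : DifferentiableAt ℝ (fun x => (supAffine ψ S x).toReal) x) {z : Rn n}
    (hz : supAffine ψ S z ≠ ⊤) :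
    (supAffine ψ S x).toReal + inner ℝ (gradient (fun x => (supAffine ψ S x).toReal) x) (z - x)
      ≤ (supAffine ψ S z).toReal := by
  set p := gradient (fun x => (supAffine ψ S x).toReal) x with hp
  refine le_of_forall_pos_le_add fun ε hε => ?_
  obtain ⟨δ, hδ, h⟩ := exists_forall_norm_sub_gradient_le hx hd
    (ε := ε / 2 / (‖z - x‖ + 1)) (by positivity)
  obtain ⟨y, hy, hyδ⟩ := exists_mem_sub_le (interior_subset hx).ne h0
    (δ := min δ (ε / 2)) (by positivity)
  have h1 := h y hy ((sub_le_sub_left (min_le_left _ _) _).trans hyδ)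
  have h2 := sub_le_toReal_supAffine hz hy
  have h3 : inner ℝ (p - y) (z - x) ≤ ε / 2 := by
    refine (real_inner_le_norm _ _).trans ?_
    rw [norm_sub_rev]
    calc _ ≤ ε / 2 / (‖z - x‖ + 1) * ‖z - x‖ := by gcongr
      _ ≤ ε / 2 := by
        rw [div_mul_eq_mul_div, div_le_iff₀ (by positivity)]
        nlinarith [norm_nonneg (z - x)]
  have h4 := min_le_right δ (ε / 2)
  rw [inner_sub_left, inner_sub_right y, real_inner_comm z, real_inner_comm x y] at h3
  linarith

/-- One-sided envelope estimate for the perturbation `ψ + t h`. -/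
theorem ofReal_gradient_le_liminf {x : Rn n} (h0 : 1 ≤ supAffine ψ S x)
    (hx : x ∈ interior {x | supAffine ψ S x < ⊤})
    (hd : DifferentiableAt ℝ (fun x => (supAffine ψ S x).toReal) x) {h : Rn n → ℝ}
    (hc : Continuous h) (hnn : ∀ y, 0 ≤ h y) {t : ℕ → ℝ} (ht : ∀ j, 0 < t j)
    (ht0 : Tendsto t atTop (𝓝 0)) :
    ENNReal.ofReal (h (gradient (fun x => (supAffine ψ S x).toReal) x)) ≤ liminf (fun j =>
      (supAffine ψ S x - supAffine (fun y => ψ y + t j * h y) S x) / ENNReal.ofReal (t j))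
      atTop := by
  set p := gradient (fun x => (supAffine ψ S x).toReal) x with hp
  have hfin : supAffine ψ S x ≠ ⊤ := (interior_subset hx).ne
  set F := (supAffine ψ S x).toReal with hF
  have hF1 : 1 ≤ F := by
    rw [hF, ← ENNReal.toReal_one]; exact ENNReal.toReal_mono hfin h0
  have key : ∀ ε : ℝ, 0 < ε → ENNReal.ofReal (h p - ε) ≤ liminf (fun j =>
      (supAffine ψ S x - supAffine (fun y => ψ y + t j * h y) S x) / ENNReal.ofReal (t j))
      atTop := by
    intro ε hε
    rcases le_total (h p - ε) 0 with hneg | hpos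
    · rw [ENNReal.ofReal_of_nonpos hneg]; exact zero_le
    obtain ⟨η, hη, hηp⟩ := Metric.continuousAt_iff.1 (hc.continuousAt (x := p)) ε hε
    obtain ⟨δ, hδ, hδp⟩ := exists_forall_norm_sub_gradient_le hx hd (half_pos hη)
    -- The bound by `δ` handles the `y` far from optimal; the bound by `1 ≤ F` keeps the new value
    -- nonnegative.
    have hsmall : ∀ᶠ j in atTop, t j * (h p - ε) < min δ 1 :=
      (by simpa using ht0.mul_const (h p - ε) :
        Tendsto (fun j => t j * (h p - ε)) atTop (𝓝 0)).eventually_lt_const (by positivity)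
    refine le_liminf_of_le (by isBoundedDefault) ?_
    filter_upwards [hsmall] with j hj
    have hj1 := hj.trans_le (min_le_left _ _)
    have hj2 := hj.trans_le (min_le_right _ _)
    have htj := ht j
    rw [ENNReal.le_div_iff_mul_le (Or.inl (by simpa using htj)) (Or.inl ENNReal.ofReal_ne_top),
      ← ENNReal.ofReal_mul hpos]
    have h1 : supAffine (fun y => ψ y + t j * h y) S x
        ≤ ENNReal.ofReal (F - t j * (h p - ε)) := by
      refine supAffine_le_iff.2 fun y hy => ENNReal.ofReal_le_ofReal ?_
      -- Nearly optimal `y` are close to `p`, so the perturbation lowers their affine functions by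
      -- `t j * (h p - ε)`. The others were already lower by `δ`, and `h ≥ 0` does not raise them.
      rcases le_or_gt (F - δ) (inner ℝ x y - ψ y) with hnear | hfar
      · have h2 := hδp y hy hnear
        have h3 := hηp (x := y) (by rw [dist_eq_norm]; linarith)
        rw [Real.dist_eq] at h3
        have h4 := (abs_lt.1 h3).1
        have h5 := sub_le_toReal_supAffine hfin hy
        nlinarith
      · have := mul_nonneg htj.le (hnn y)
        linarith
    refine le_trans ?_ (tsub_le_tsub_left h1 _)
    rw [← ENNReal.ofReal_toReal hfin, ← ENNReal.ofReal_sub _ (by linarith)]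
    exact ENNReal.ofReal_le_ofReal (by linarith)
  refine le_of_tendsto' (f := fun k : ℕ => ENNReal.ofReal (h p - 1 / ((k : ℝ) + 1)))
    (x := atTop) ?_ fun k => key _ (by positivity)
  refine (ENNReal.continuous_ofReal.tendsto _).comp ?_
  simpa using tendsto_const_nhds.sub (tendsto_one_div_add_atTop_nhds_zero_nat (𝕜 := ℝ))

end Convexity

/-! ### First variation and the Euler-Lagrange equation. -/

theorem ennreal_liminf_add_le (u v : ℕ → ℝ≥0∞) :
    liminf u atTop + liminf v atTop ≤ liminf (fun j => u j + v j) atTop := by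
  simp only [liminf_eq_iSup_iInf_of_nat]
  have hm : ∀ w : ℕ → ℝ≥0∞, Monotone fun n : ℕ => ⨅ i ≥ n, w i := fun w i j hij =>
    biInf_mono fun k hk => hij.trans hk
  rw [ENNReal.iSup_add_iSup_of_monotone (hm u) (hm v)]
  refine iSup_mono fun k => le_iInf₂ fun i hi => add_le_add (iInf₂_le i hi) (iInf₂_le i hi)

theorem tendsto_one_sub_rpow_slope (q I : ℝ) {t : ℕ → ℝ} (ht : ∀ j, 0 < t j)
    (ht0 : Tendsto t atTop (𝓝 0)) :
    Tendsto (fun j => ((1 - t j * I) ^ (-q) - 1) / t j) atTop (𝓝 (q * I)) := by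
  have h1 : HasDerivAt (fun t : ℝ => (1 - t * I) ^ (-q)) (q * I) 0 := by
    have := (((hasDerivAt_id (0 : ℝ)).mul_const I).const_sub 1).rpow_const (p := -q)
      (Or.inl (by simp))
    simpa [mul_comm] using this
  have h2 := (hasDerivAt_iff_tendsto_slope.1 h1).comp (tendsto_nhdsWithin_iff.2
    ⟨ht0, Eventually.of_forall fun j => (ht j).ne'⟩)
  refine h2.congr fun j => ?_
  simp [slope_def_field]

section Variation

variable {n : ℕ} {μ : Measure (Rn n)} {ψ : Rn n → ℝ} {S : Set (Rn n)} {β : ℝ}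

/-- The gradient of the finite part of `supAffine ψ S`. -/
noncomputable def gradSup (ψ : Rn n → ℝ) (S : Set (Rn n)) (x : Rn n) : Rn n :=
  gradient (fun x => (supAffine ψ S x).toReal) x

theorem measurable_gradSup : Measurable (gradSup ψ S) :=
  (InnerProductSpace.toDual ℝ (Rn n)).symm.continuous.measurable.comp (measurable_fderiv ℝ _)

theorem lintegral_map_gradSup (p : ℝ) {w : Rn n → ℝ≥0∞} (hw : Measurable w) :
    ∫⁻ y, w y ∂((volume.withDensity fun x => supAffine ψ S x ^ p).map (gradSup ψ S))
      = ∫⁻ x, supAffine ψ S x ^ p * w (gradSup ψ S x) := by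
  rw [lintegral_map hw measurable_gradSup]
  exact lintegral_withDensity_eq_lintegral_mul _ (measurable_supAffine.pow_const _)
    (hw.comp measurable_gradSup)

theorem supAffine_add_le {h : Rn n → ℝ} (hnn : ∀ y, 0 ≤ h y) {t : ℝ} (ht : 0 ≤ t) (x : Rn n) :
    supAffine (fun y => ψ y + t * h y) S x ≤ supAffine ψ S x :=
  iSup₂_mono fun y _ => ENNReal.ofReal_le_ofReal (by nlinarith [mul_nonneg ht (hnn y)])

/-- The tangent inequality bounds the perturbed functional from below, with a separate term for the
points where `f` is infinite and the perturbed function may not be. Homogeneity with `a = 1 - t ∫ h`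
bounds it from above, and the finite `J` cancels. -/
theorem variation_le (hβ : (n : ℝ) < β)
    (hmax : ∀ ψ' S', Admissible μ ψ' S' →
      negPowInt β (supAffine ψ' S') ≤ negPowInt β (supAffine ψ S))
    (hadm : Admissible μ ψ S) (htop : negPowInt β (supAffine ψ S) ≠ ⊤)
    (hI : ∫ y, ψ y ∂μ = -1) {h : Rn n → ℝ} (hnn : ∀ y, 0 ≤ h y) (hi : Integrable h μ)
    {t : ℝ} (ht : 0 < t) (htI : t * ∫ y, h y ∂μ < 1) :
    ENNReal.ofReal β * (∫⁻ x, supAffine ψ S x ^ (-β - 1) *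
        ((supAffine ψ S x - supAffine (fun y => ψ y + t * h y) S x) / ENNReal.ofReal t))
      + (∫⁻ x in {x | supAffine ψ S x = ⊤},
          supAffine (fun y => ψ y + t * h y) S x ^ (-β)) / ENNReal.ofReal t
      ≤ negPowInt β (supAffine ψ S)
        * ENNReal.ofReal (((1 - t * ∫ y, h y ∂μ) ^ (-(β - n)) - 1) / t) := by
  set f := supAffine ψ S with hf
  set g := supAffine (fun y => ψ y + t * h y) S with hg
  set J := negPowInt β f with hJ
  set a := 1 - t * ∫ y, h y ∂μ with ha
  have hβ0 : 0 < β := (Nat.cast_nonneg n).trans_lt hβ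
  have hfm : Measurable f := measurable_supAffine
  have hgm : Measurable g := measurable_supAffine
  have hI0 : 0 ≤ ∫ y, h y ∂μ := integral_nonneg hnn
  have ha0 : 0 < a := by rw [ha]; linarith
  have ha1 : a ≤ 1 := by rw [ha]; nlinarith [mul_nonneg ht.le hI0]
  have hgf : ∀ x, g x ≤ f x := supAffine_add_le hnn ht.le
  have h1 : negPowInt β g * ENNReal.ofReal (a ^ (β - n)) ≤ J := by
    refine negPowInt_mul_le hβ0.le hmax (hadm.integrable.add (hi.const_mul t)) hadm.ae_mem ha0 ?_
    have := integral_add hadm.integrable (hi.const_mul t)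
    simp only [Pi.add_apply] at this ⊢
    rw [this, integral_const_mul, hI]
    ring
  have h2 : negPowInt β g ≤ J * ENNReal.ofReal (a ^ (-(β - n))) := by
    have hpos : 0 < a ^ (β - n) := Real.rpow_pos_of_pos ha0 _
    rw [Real.rpow_neg ha0.le, ENNReal.ofReal_inv_of_pos hpos, ← div_eq_mul_inv,
      ENNReal.le_div_iff_mul_le (Or.inl (by simpa using hpos)) (Or.inl ENNReal.ofReal_ne_top)]
    exact h1
  set X := ENNReal.ofReal β * ∫⁻ x, f x ^ (-β - 1) * (f x - g x) with hX
  set Y := ∫⁻ x in {x | f x = ⊤}, g x ^ (-β) with hY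
  have hset : MeasurableSet {x | f x = ⊤} := hfm (measurableSet_singleton ⊤)
  have h3 : J + (X + Y) ≤ negPowInt β g := by
    rw [hX, hY, hJ, negPowInt, negPowInt, ← lintegral_const_mul' _ _ ENNReal.ofReal_ne_top,
      ← lintegral_indicator hset, ← lintegral_add_left, ← lintegral_add_left]
    · refine lintegral_mono fun x => ?_
      by_cases hx : f x = ⊤
      · simp [hx, ENNReal.top_rpow_of_neg, hβ0, show -β - 1 < 0 by linarith]
      · simp only [mem_ofPred_eq, hx, not_false_eq_true, indicator_of_notMem, add_zero]
        exact rpow_neg_add_le hβ0 (hgf x)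
    · exact hfm.pow_const _
    · exact ((hfm.pow_const _).mul (hfm.sub hgm)).const_mul _
  have h4 : X + Y ≤ J * ENNReal.ofReal (a ^ (-(β - n)) - 1) := by
    have h5 : 1 ≤ a ^ (-(β - n)) := Real.one_le_rpow_of_pos_of_le_one_of_nonpos ha0 ha1
      (by linarith)
    have h6 := h3.trans h2
    have e : a ^ (-(β - n)) = 1 + (a ^ (-(β - n)) - 1) := by ring
    rw [e, ENNReal.ofReal_add zero_le_one (by linarith), mul_add, ENNReal.ofReal_one, mul_one] at h6
    exact (ENNReal.add_le_add_iff_left htop).1 h6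
  have h7 : (X + Y) / ENNReal.ofReal t ≤ J * ENNReal.ofReal (a ^ (-(β - n)) - 1)
      / ENNReal.ofReal t := by gcongr
  rw [mul_div_assoc, ← ENNReal.ofReal_div_of_pos ht, ENNReal.add_div] at h7
  refine le_trans (le_of_eq ?_) h7
  congr 1
  rw [hX, mul_div_assoc]
  congr 1
  simp only [div_eq_mul_inv, ← mul_assoc]
  exact lintegral_mul_const' _ _ (by simp [ht])

/-- Limit of `variation_le` as `t → 0`: Fatou's lemma and the envelope estimate treat the interior,
while the boundary term is kept as a lower limit. -/
theorem first_variation (hβ : (n : ℝ) < β)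
    (hmax : ∀ ψ' S', Admissible μ ψ' S' →
      negPowInt β (supAffine ψ' S') ≤ negPowInt β (supAffine ψ S))
    (hadm : Admissible μ ψ S) (htop : negPowInt β (supAffine ψ S) ≠ ⊤)
    (hone : ∀ x, 1 ≤ supAffine ψ S x)
    (hI : ∫ y, ψ y ∂μ = -1) {h : Rn n → ℝ} (hc : Continuous h) (hnn : ∀ y, 0 ≤ h y)
    (hi : Integrable h μ) {t : ℕ → ℝ} (ht : ∀ j, 0 < t j) (ht0 : Tendsto t atTop (𝓝 0)) :
    ENNReal.ofReal β * (∫⁻ x, supAffine ψ S x ^ (-β - 1) * ENNReal.ofReal (h (gradSup ψ S x)))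
      + liminf (fun j => (∫⁻ x in {x | supAffine ψ S x = ⊤},
          supAffine (fun y => ψ y + t j * h y) S x ^ (-β)) / ENNReal.ofReal (t j)) atTop
      ≤ negPowInt β (supAffine ψ S) * ENNReal.ofReal ((β - n) * ∫ y, h y ∂μ) := by
  set f := supAffine ψ S with hf
  set g := fun j => supAffine (fun y => ψ y + t j * h y) S with hg
  set J := negPowInt β f with hJ
  have hβ0 : 0 < β := (Nat.cast_nonneg n).trans_lt hβ
  have hfm : Measurable f := measurable_supAffine
  have h1 : ∀ᵐ x, f x ^ (-β - 1) * ENNReal.ofReal (h (gradSup ψ S x)) ≤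
      liminf (fun j => f x ^ (-β - 1) * ((f x - g j x) / ENNReal.ofReal (t j))) atTop := by
    filter_upwards [ae_top_or_differentiableAt ψ S] with x hx
    rcases hx with hx | ⟨hx, hd⟩
    · simp [hf, hx, show -β - 1 < 0 by linarith]
    have h2 := ofReal_gradient_le_liminf (hone x) hx hd hc hnn ht ht0
    have hne : f x ^ (-β - 1) ≠ ⊤ := by
      rw [show -β - 1 = -(β + 1) by ring, ENNReal.rpow_neg]
      simp only [ne_eq, ENNReal.inv_eq_top]
      exact (ENNReal.rpow_pos (zero_lt_one.trans_le (hone x)) (interior_subset hx).ne).ne'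
    refine (mul_le_mul_right h2 _).trans ?_
    refine le_trans (le_of_eq ?_) (ENNReal.le_liminf_mul)
    rw [liminf_const]
  have h2 : ∫⁻ x, f x ^ (-β - 1) * ENNReal.ofReal (h (gradSup ψ S x)) ≤
      liminf (fun j => ∫⁻ x, f x ^ (-β - 1) * ((f x - g j x) / ENNReal.ofReal (t j))) atTop :=
    (lintegral_mono_ae h1).trans (lintegral_liminf_le fun j =>
      (hfm.pow_const _).mul ((hfm.sub measurable_supAffine).div_const _))
  have h3 : ENNReal.ofReal β * ∫⁻ x, f x ^ (-β - 1) * ENNReal.ofReal (h (gradSup ψ S x)) ≤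
      liminf (fun j => ENNReal.ofReal β *
        ∫⁻ x, f x ^ (-β - 1) * ((f x - g j x) / ENNReal.ofReal (t j))) atTop := by
    refine (mul_le_mul_right h2 _).trans ?_
    refine le_trans (le_of_eq ?_) (ENNReal.le_liminf_mul)
    rw [liminf_const]
  refine (add_le_add_left h3 _).trans ((ennreal_liminf_add_le _ _).trans ?_)
  have h4 : Tendsto (fun j => J * ENNReal.ofReal
      (((1 - t j * ∫ y, h y ∂μ) ^ (-(β - n)) - 1) / t j)) atTop
      (𝓝 (J * ENNReal.ofReal ((β - n) * ∫ y, h y ∂μ))) :=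
    ENNReal.Tendsto.const_mul ((ENNReal.continuous_ofReal.tendsto _).comp
      (tendsto_one_sub_rpow_slope _ _ ht ht0)) (Or.inr htop)
  rw [← h4.liminf_eq]
  refine liminf_le_liminf ?_
  have h5 : Tendsto (fun j => t j * ∫ y, h y ∂μ) atTop (𝓝 0) := by
    simpa using ht0.mul_const (∫ y, h y ∂μ)
  filter_upwards [h5.eventually_lt_const one_pos] with j hj
  exact variation_le hβ hmax hadm htop hI hnn hi (ht j) hj

/-- Perturbs by a negative constant, a direction not covered by `first_variation`: passing from `ψ`
to `ψ - t` raises `f` by at most `t`, so the tangent inequality applies from the other side. This is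
the missing half of the mass identity. -/
theorem le_mass (hβ : (n : ℝ) < β) [IsProbabilityMeasure μ]
    (hmax : ∀ ψ' S', Admissible μ ψ' S' →
      negPowInt β (supAffine ψ' S') ≤ negPowInt β (supAffine ψ S))
    (hadm : Admissible μ ψ S) (htop : negPowInt β (supAffine ψ S) ≠ ⊤)
    (hone : ∀ x, 1 ≤ supAffine ψ S x) (hI : ∫ y, ψ y ∂μ = -1) :
    negPowInt β (supAffine ψ S) * ENNReal.ofReal (β - n)
      ≤ ENNReal.ofReal β * ∫⁻ x, supAffine ψ S x ^ (-β - 1) := by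
  set f := supAffine ψ S with hf
  set J := negPowInt β f with hJ
  set E := ∫⁻ x, f x ^ (-β - 1) with hE
  have hβ0 : 0 < β := (Nat.cast_nonneg n).trans_lt hβ
  have key : ∀ t : ℝ, 0 < t → J * ENNReal.ofReal ((1 - (1 + t) ^ (-(β - n))) / t)
      ≤ ENNReal.ofReal β * E := by
    intro t ht
    have hpos : 0 < (1 + t) ^ (β - n) := by positivity
    have h1 : negPowInt β (supAffine (fun y => ψ y - t) S) * ENNReal.ofReal ((1 + t) ^ (β - n))
        ≤ J := by
      refine negPowInt_mul_le hβ0.le hmax (hadm.integrable.sub (integrable_const t)) hadm.ae_mem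
        (by positivity) ?_
      have := integral_sub hadm.integrable (integrable_const t)
      simp only [Pi.sub_apply] at this ⊢
      rw [this, hI]
      simp; ring
    have h2 : negPowInt β (supAffine (fun y => ψ y - t) S)
        ≤ J * ENNReal.ofReal ((1 + t) ^ (-(β - n))) := by
      rw [Real.rpow_neg (by positivity), ENNReal.ofReal_inv_of_pos hpos, ← div_eq_mul_inv,
        ENNReal.le_div_iff_mul_le (Or.inl (by simpa using hpos)) (Or.inl ENNReal.ofReal_ne_top)]
      exact h1
    have h3 : J ≤ negPowInt β (fun x => f x + ENNReal.ofReal t) + ENNReal.ofReal (β * t) * E := by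
      rw [hJ, hE, negPowInt, negPowInt, ← lintegral_const_mul' _ _ ENNReal.ofReal_ne_top,
        ← lintegral_add_left ((measurable_supAffine.add_const _).pow_const _)]
      exact lintegral_mono fun x => rpow_neg_le_add hβ0 ht.le (zero_lt_one.trans_le (hone x)).ne'
    have h4 : negPowInt β (fun x => f x + ENNReal.ofReal t)
        ≤ negPowInt β (supAffine (fun y => ψ y - t) S) := by
      refine negPowInt_anti hβ0.le fun x => supAffine_le_iff.2 fun y hy => ?_
      rw [show inner ℝ x y - (ψ y - t) = inner ℝ x y - ψ y + t by ring]
      exact ENNReal.ofReal_add_le.trans (add_le_add_left (ofReal_le_supAffine ψ hy x) _)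
    have h5 := h3.trans (add_le_add_left (h4.trans h2) _)
    have hle1 : (1 + t) ^ (-(β - n)) ≤ 1 :=
      Real.rpow_le_one_of_one_le_of_nonpos (by linarith) (by linarith)
    have hp : 0 < (1 + t) ^ (-(β - n)) := by positivity
    have e : (1 : ℝ≥0∞) = ENNReal.ofReal ((1 + t) ^ (-(β - n)))
        + ENNReal.ofReal (1 - (1 + t) ^ (-(β - n))) := by
      rw [← ENNReal.ofReal_add hp.le (by linarith)]; simp
    have h6 : J * ENNReal.ofReal (1 - (1 + t) ^ (-(β - n))) ≤ ENNReal.ofReal (β * t) * E := by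
      conv_lhs at h5 => rw [← mul_one J, e, mul_add]
      exact (ENNReal.add_le_add_iff_left (ENNReal.mul_ne_top htop ENNReal.ofReal_ne_top)).1 h5
    rw [ENNReal.ofReal_div_of_pos ht, ← mul_div_assoc,
      ENNReal.div_le_iff_le_mul (Or.inl (by simpa using ht)) (Or.inl ENNReal.ofReal_ne_top)]
    refine h6.trans (le_of_eq ?_)
    rw [ENNReal.ofReal_mul hβ0.le]; ring
  have hlim := tendsto_one_sub_rpow_slope (β - n) (-1) (t := fun j : ℕ => 1 / ((j : ℝ) + 1))
    (fun j => by positivity) tendsto_one_div_add_atTop_nhds_zero_nat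
  have hlim2 : Tendsto (fun j : ℕ => J * ENNReal.ofReal
      ((1 - (1 + 1 / ((j : ℝ) + 1)) ^ (-(β - n))) / (1 / ((j : ℝ) + 1)))) atTop
      (𝓝 (J * ENNReal.ofReal (β - n))) := by
    refine ENNReal.Tendsto.const_mul ((ENNReal.continuous_ofReal.tendsto _).comp ?_) (Or.inr htop)
    have := hlim.neg
    simp only [mul_neg, mul_one, neg_neg, sub_neg_eq_add] at this
    refine this.congr fun j => ?_
    rw [← neg_div, neg_sub]
  exact le_of_tendsto' hlim2 fun j => key _ (by positivity)

/-- The Euler-Lagrange equation: the gradient transports `f ^ (-β - 1) dx` to a multiple of `μ`. -/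
theorem map_gradSup_eq (hβ : (n : ℝ) < β) [IsProbabilityMeasure μ]
    (hmax : ∀ ψ' S', Admissible μ ψ' S' →
      negPowInt β (supAffine ψ' S') ≤ negPowInt β (supAffine ψ S))
    (hadm : Admissible μ ψ S) (htop : negPowInt β (supAffine ψ S) ≠ ⊤)
    (hone : ∀ x, 1 ≤ supAffine ψ S x) (hI : ∫ y, ψ y ∂μ = -1) :
    (volume.withDensity fun x => supAffine ψ S x ^ (-β - 1)).map (gradSup ψ S)
      = (negPowInt β (supAffine ψ S) * ENNReal.ofReal (β - n) / ENNReal.ofReal β) • μ := by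
  set f := supAffine ψ S with hf
  set J := negPowInt β f with hJ
  set C := J * ENNReal.ofReal (β - n) / ENNReal.ofReal β with hC
  set ν := (volume.withDensity fun x => f x ^ (-β - 1)).map (gradSup ψ S) with hν
  have hβ0 : 0 < β := (Nat.cast_nonneg n).trans_lt hβ
  have hβe : ENNReal.ofReal β ≠ 0 := by simpa using hβ0
  have hfm : Measurable f := measurable_supAffine
  have hCtop : C ≠ ⊤ :=
    ENNReal.div_ne_top (ENNReal.mul_ne_top htop ENNReal.ofReal_ne_top) hβe
  have hle : ∀ g : BoundedContinuousFunction (Rn n) NNReal,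
      ∫⁻ y, g y ∂ν ≤ C * ∫⁻ y, g y ∂μ := by
    intro g
    have hcont : Continuous fun y => (g y : ℝ) := NNReal.continuous_coe.comp g.continuous
    have hint : Integrable (fun y => (g y : ℝ)) μ := by
      refine (integrable_const (nndist g 0 : ℝ)).mono' hcont.aestronglyMeasurable
        (Eventually.of_forall fun y => ?_)
      rw [NNReal.norm_eq]
      exact_mod_cast BoundedContinuousFunction.NNReal.upper_bound g y
    have h1 := le_self_add.trans (first_variation hβ hmax hadm htop hone hI hcont
      (fun y => (g y).2) hint (t := fun j : ℕ => 1 / ((j : ℝ) + 1)) (fun j => by positivity)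
      tendsto_one_div_add_atTop_nhds_zero_nat)
    rw [ENNReal.ofReal_mul (by linarith), ofReal_integral_eq_lintegral_ofReal hint
      (Eventually.of_forall fun y => (g y).2)] at h1
    simp only [ENNReal.ofReal_coe_nnreal] at h1
    rw [hν, lintegral_map_gradSup _ (by fun_prop), hC, ENNReal.div_eq_inv_mul, mul_assoc,
      ← ENNReal.mul_le_iff_le_inv hβe ENNReal.ofReal_ne_top, mul_assoc]
    exact h1
  have hmass : C ≤ ν univ := by
    rw [hν, Measure.map_apply measurable_gradSup MeasurableSet.univ, preimage_univ,
      withDensity_apply _ MeasurableSet.univ, Measure.restrict_univ, hC,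
      ENNReal.div_le_iff_le_mul (Or.inl hβe) (Or.inl ENNReal.ofReal_ne_top),
      mul_comm _ (ENNReal.ofReal β)]
    exact le_mass hβ hmax hadm htop hone hI
  have hmass' : ν univ ≤ C := by
    simpa using hle (BoundedContinuousFunction.const _ 1)
  have : IsFiniteMeasure ν := ⟨hmass'.trans_lt hCtop.lt_top⟩
  refine ext_of_forall_lintegral_eq_of_IsFiniteMeasure fun g => ?_
  rw [lintegral_smul_measure, smul_eq_mul]
  refine le_antisymm (hle g) ?_
  -- The inequality applied to `H - g`, combined with equality of the total masses, yields the
  -- reverse inequality for `g`.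
  set H : NNReal := nndist g 0
  have hgH : ∀ y, g y ≤ H := BoundedContinuousFunction.NNReal.upper_bound g
  have hsum : ∀ m : Measure (Rn n), ∫⁻ y, g y ∂m
      + ∫⁻ y, (BoundedContinuousFunction.const (Rn n) H - g : BoundedContinuousFunction _ _) y ∂m
        = H * m univ := by
    intro m
    rw [← lintegral_add_left (by fun_prop), ← lintegral_const]
    refine lintegral_congr fun y => ?_
    rw [← ENNReal.coe_add]
    simp [add_tsub_cancel_of_le (hgH y)]
  have h1 := hsum ν
  have h2 := congrArg (C * ·) (hsum μ)
  simp only [measure_univ, mul_one, mul_add] at h2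
  have h3 := hle (BoundedContinuousFunction.const (Rn n) H - g)
  have h4 : C * ∫⁻ y, g y ∂μ + C * ∫⁻ y, (BoundedContinuousFunction.const (Rn n) H - g :
      BoundedContinuousFunction _ _) y ∂μ ≤ ∫⁻ y, g y ∂ν + C * ∫⁻ y,
      (BoundedContinuousFunction.const (Rn n) H - g : BoundedContinuousFunction _ _) y ∂μ := by
    rw [h2, mul_comm]
    calc (H : ℝ≥0∞) * C ≤ H * ν univ := by gcongr
      _ = _ := h1.symm
      _ ≤ _ := by gcongr
  refine (ENNReal.add_le_add_iff_right ?_).1 h4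
  refine ne_top_of_le_ne_top (ENNReal.mul_ne_top ENNReal.coe_ne_top hCtop : (H : ℝ≥0∞) * C ≠ ⊤) ?_
  rw [mul_comm (H : ℝ≥0∞), ← h2]
  exact le_add_self

/-- The boundary term in the first variation vanishes. -/
theorem liminf_outside_eq_zero (hβ : (n : ℝ) < β) [IsProbabilityMeasure μ]
    (hmoment : Integrable (fun x : Rn n => ‖x‖) μ)
    (hmax : ∀ ψ' S', Admissible μ ψ' S' →
      negPowInt β (supAffine ψ' S') ≤ negPowInt β (supAffine ψ S))
    (hadm : Admissible μ ψ S) (htop : negPowInt β (supAffine ψ S) ≠ ⊤)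
    (hone : ∀ x, 1 ≤ supAffine ψ S x) (hI : ∫ y, ψ y ∂μ = -1)
    {t : ℕ → ℝ} (ht : ∀ j, 0 < t j) (ht0 : Tendsto t atTop (𝓝 0)) :
    liminf (fun j => (∫⁻ x in {x | supAffine ψ S x = ⊤},
      supAffine (fun y => ψ y + t j * ‖y‖) S x ^ (-β)) / ENNReal.ofReal (t j)) atTop = 0 := by
  have hβ0 : 0 < β := (Nat.cast_nonneg n).trans_lt hβ
  have hβe : ENNReal.ofReal β ≠ 0 := by simpa using hβ0
  have h1 := first_variation hβ hmax hadm htop hone hI continuous_norm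
    (fun y => norm_nonneg y) hmoment ht ht0
  -- Integrating `‖·‖` in the transport identity shows that the interior term alone equals the
  -- finite right-hand side, leaving no room for the boundary term.
  have h2 : ENNReal.ofReal β * ∫⁻ x, supAffine ψ S x ^ (-β - 1) *
      ENNReal.ofReal ‖gradSup ψ S x‖ =
      negPowInt β (supAffine ψ S) * ENNReal.ofReal ((β - n) * ∫ y, ‖y‖ ∂μ) := by
    have h3 := congrArg (fun m : Measure (Rn n) => ∫⁻ y, ENNReal.ofReal ‖y‖ ∂m)
      (map_gradSup_eq hβ hmax hadm htop hone hI)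
    simp only [lintegral_smul_measure, smul_eq_mul] at h3
    rw [lintegral_map_gradSup _ (by fun_prop), ← ofReal_integral_eq_lintegral_ofReal hmoment
        (Eventually.of_forall fun y => norm_nonneg y)] at h3
    rw [h3, ENNReal.ofReal_mul (by linarith), ← mul_assoc, ← mul_assoc,
      ENNReal.mul_div_cancel hβe ENNReal.ofReal_ne_top]
  rw [h2] at h1
  have h4 : negPowInt β (supAffine ψ S) * ENNReal.ofReal ((β - n) * ∫ y, ‖y‖ ∂μ) ≠ ⊤ :=
    ENNReal.mul_ne_top htop ENNReal.ofReal_ne_top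
  rw [← add_zero (negPowInt β _ * _), add_assoc, ENNReal.add_le_add_iff_left h4, zero_add] at h1
  exact le_zero_iff.1 h1

end Variation

/-! ### Surface measure of boundary parts with thin outer neighbourhoods. -/

section Hausdorff

variable {n : ℕ}

/-- At least half of a ball centred at a boundary point of a convex set is outside the set. -/
theorem volume_ball_le_two_mul_diff {K : Set (Rn n)} (hK : Convex ℝ K) (hc : IsClosed K)
    {z : Rn n} (hz : z ∈ frontier K) (r : ℝ) :
    volume (Metric.ball z r) ≤ 2 * volume (Metric.ball z r \ K) := by
  have h1 : volume (Metric.ball z r ∩ interior K) ≤ volume (Metric.ball z r \ K) := by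
    -- Reflect in `z`: the mirror image of an interior point of `K` cannot lie in `K`, or the
    -- midpoint `z` would be interior.
    have hmp := Measure.measurePreserving_sub_left (volume : Measure (Rn n)) (z + z)
    rw [← hmp.measure_preimage
      (measurableSet_ball.inter isOpen_interior.measurableSet).nullMeasurableSet]
    refine measure_mono fun x hx => ⟨?_, fun hxK => ?_⟩
    · have := hx.1
      rw [Metric.mem_ball, dist_eq_norm] at this ⊢
      rwa [show z + z - x - z = -(x - z) by abel, norm_neg] at this
    · refine hz.2 (hK.openSegment_interior_closure_subset_interior hx.2 (subset_closure hxK) ?_)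
      refine ⟨1 / 2, 1 / 2, by norm_num, by norm_num, by norm_num, ?_⟩
      rw [← smul_add, sub_add_cancel, ← two_smul ℝ z, smul_smul]
      norm_num
  have h2 : volume (Metric.ball z r ∩ K) ≤ volume (Metric.ball z r ∩ interior K) := by
    have h3 : Metric.ball z r ∩ K ⊆ (Metric.ball z r ∩ interior K) ∪ frontier K := by
      intro x hx
      by_cases hi : x ∈ interior K
      · exact Or.inl ⟨hx.1, hi⟩
      · exact Or.inr ⟨subset_closure hx.2, hi⟩
    refine (measure_mono h3).trans ((measure_union_le _ _).trans ?_)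
    rw [hK.addHaar_frontier volume, add_zero]
  rw [← measure_inter_add_sdiff (Metric.ball z r) hc.measurableSet, two_mul]
  exact add_le_add_left (h2.trans h1) _

/-- Balls of radius `s / 2` about `s`-separated points are disjoint, and each has at least half its
volume outside `K`. -/
theorem card_mul_volume_ball_le {K A : Set (Rn n)} (hK : Convex ℝ K) (hc : IsClosed K)
    (hA : A ⊆ frontier K) {s : NNReal} (hs : 0 < s) {F : Finset (Rn n)} (hF : ↑F ⊆ A)
    (hsep : Metric.IsSeparated (s : ℝ≥0∞) (F : Set (Rn n))) :
    F.card * (ENNReal.ofReal ((s / 2 : ℝ) ^ n) * volume (Metric.ball (0 : Rn n) 1))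
      ≤ 2 * volume (Metric.thickening s A \ K) := by
  have hs0 : (0 : ℝ) < s := hs
  have h1 : ∀ z ∈ F, ENNReal.ofReal ((s / 2 : ℝ) ^ n) * volume (Metric.ball (0 : Rn n) 1)
      ≤ 2 * volume (Metric.ball z (s / 2) \ K) := by
    intro z hz
    refine le_trans (le_of_eq ?_) (volume_ball_le_two_mul_diff hK hc (hA (hF hz)) _)
    rw [Measure.addHaar_ball_of_pos volume z (by positivity)]
    simp
  have h2 : ∑ z ∈ F, volume (Metric.ball z (s / 2 : ℝ) \ K)
      ≤ volume (Metric.thickening s A \ K) := by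
    rw [← measure_biUnion_finset]
    · refine measure_mono (iUnion₂_subset fun z hz => ?_)
      refine sdiff_subset_sdiff_left fun x hx => ?_
      rw [Metric.mem_thickening_iff]
      exact ⟨z, hF hz, (Metric.mem_ball.1 hx).trans (by linarith)⟩
    · intro z hz z' hz' hne
      refine (Metric.ball_disjoint_ball ?_).mono sdiff_subset sdiff_subset
      have : (s : ℝ≥0∞) < edist z z' := hsep hz hz' hne
      rw [edist_dist, ← ENNReal.ofReal_coe_nnreal] at this
      have := (ENNReal.ofReal_lt_ofReal_iff_of_nonneg hs0.le).1 this
      linarith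
    · exact fun z _ => measurableSet_ball.diff hc.measurableSet
  calc _ = ∑ z ∈ F, ENNReal.ofReal ((s / 2 : ℝ) ^ n) * volume (Metric.ball (0 : Rn n) 1) := by
        rw [Finset.sum_const, nsmul_eq_mul]
    _ ≤ ∑ z ∈ F, 2 * volume (Metric.ball z (s / 2 : ℝ) \ K) := Finset.sum_le_sum h1
    _ ≤ _ := by rw [← Finset.mul_sum]; gcongr

/-- A maximal `s`-separated subset of `A` is also an `s`-net; the volume bound makes it finite and
counts it. -/
theorem exists_finite_cover {K A : Set (Rn n)} (hK : Convex ℝ K) (hc : IsClosed K)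
    (hA : A ⊆ frontier K) {s : NNReal} (hs : 0 < s)
    (hw : volume (Metric.thickening s A \ K) ≠ ⊤) :
    ∃ F : Finset (Rn n), A ⊆ ⋃ i : F, Metric.closedBall (i : Rn n) s ∧
      F.card * (ENNReal.ofReal ((s / 2 : ℝ) ^ n) * volume (Metric.ball (0 : Rn n) 1))
      ≤ 2 * volume (Metric.thickening s A \ K) := by
  have hs0 : (0 : ℝ) < s := hs
  set b := ENNReal.ofReal ((s / 2 : ℝ) ^ n) * volume (Metric.ball (0 : Rn n) 1) with hb
  have hb0 : b ≠ 0 := mul_ne_zero (by simp; positivity) (Metric.measure_ball_pos _ _ one_pos).ne'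
  obtain ⟨N, hN⟩ := ENNReal.exists_nat_mul_gt hb0 (ENNReal.mul_ne_top ENNReal.ofNat_ne_top hw :
    2 * volume (Metric.thickening s A \ K) ≠ ⊤)
  have hpack : Metric.packingNumber s A ≠ ⊤ := by
    refine ne_top_of_le_ne_top (ENat.natCast_ne_top N) (iSup₂_le fun C hC => iSup_le fun hsep => ?_)
    by_contra! hlt
    obtain ⟨T, hTC, hT⟩ := Set.exists_subset_encard_eq hlt.le
    have hfin : T.Finite := Set.finite_of_encard_eq_coe hT
    have h1 := card_mul_volume_ball_le hK hc hA hs (F := hfin.toFinset)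
      (by simpa using hTC.trans hC) (by rw [hfin.coe_toFinset]; exact hsep.mono hTC)
    have h2 : hfin.toFinset.card = N := by
      rw [hfin.encard_eq_coe_toFinset_card] at hT
      exact_mod_cast hT
    rw [h2] at h1
    exact absurd h1 (not_le.2 hN)
  have hfin : (Metric.maximalSeparatedSet s A).Finite := by
    rw [← Set.encard_ne_top_iff, Metric.encard_maximalSeparatedSet hpack]
    exact hpack
  refine ⟨hfin.toFinset, fun x hx => ?_, card_mul_volume_ball_le hK hc hA hs ?_ ?_⟩
  · obtain ⟨y, hy, hxy⟩ := Metric.isCover_maximalSeparatedSet hpack hx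
    refine mem_iUnion.2 ⟨⟨y, by simpa using hy⟩, ?_⟩
    have hxy' : edist x y ≤ s := hxy
    rw [edist_nndist, ENNReal.coe_le_coe] at hxy'
    exact hxy'
  · simpa using Metric.maximalSeparatedSet_subset
  · rw [hfin.coe_toFinset]
    exact Metric.isSeparated_maximalSeparatedSet

/-- A part of the boundary of a convex set whose outer neighbourhoods have volume `o(t)` is
negligible for the surface measure. -/
theorem hausdorffMeasure_frontier_eq_zero [NeZero n] {K A : Set (Rn n)} (hK : Convex ℝ K)
    (hc : IsClosed K) (hA : A ⊆ frontier K) {t : ℕ → ℝ} (ht : ∀ j, 0 < t j)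
    (ht0 : Tendsto t atTop (𝓝 0))
    (hlim : liminf (fun j => volume (Metric.thickening (t j) A \ K) / ENNReal.ofReal (t j)) atTop
      = 0) :
    (Measure.euclideanHausdorffMeasure (n - 1) : Measure (Rn n)) A = 0 := by
  set ω := volume (Metric.ball (0 : Rn n) 1) with hω
  have hω0 : ω ≠ 0 := (Metric.measure_ball_pos _ _ one_pos).ne'
  have hωt : ω ≠ ⊤ := measure_ball_lt_top.ne
  have hex : ∀ m : ℕ, ∃ j ≥ m, volume (Metric.thickening (t j) A \ K) / ENNReal.ofReal (t j)
      < ENNReal.ofReal (1 / ((m : ℝ) + 1)) := fun m =>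
    (frequently_lt_of_liminf_lt (by isBoundedDefault)
      (hlim.trans_lt (ENNReal.ofReal_pos.2 (by positivity)))).forall_exists_of_atTop m
  choose j hjm hj using hex
  have hjt : Tendsto (fun m => t (j m)) atTop (𝓝 0) :=
    ht0.comp (tendsto_atTop_mono hjm tendsto_id)
  have hw : ∀ m, volume (Metric.thickening (t (j m)) A \ K)
      ≤ ENNReal.ofReal (1 / ((m : ℝ) + 1)) * ENNReal.ofReal (t (j m)) := fun m => by
    rw [← ENNReal.div_le_iff_le_mul (Or.inl (by simpa using ht _)) (Or.inl ENNReal.ofReal_ne_top)]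
    exact (hj m).le
  have hcov : ∀ m, ∃ F : Finset (Rn n), A ⊆ ⋃ i : F, Metric.closedBall (i : Rn n) (t (j m)) ∧
      F.card * (ENNReal.ofReal ((t (j m) / 2 : ℝ) ^ n) * ω)
        ≤ 2 * volume (Metric.thickening (t (j m)) A \ K) := fun m => by
    have h1 := exists_finite_cover hK hc hA (s := ⟨t (j m), (ht _).le⟩) (ht (j m))
      (ne_top_of_le_ne_top (ENNReal.mul_ne_top ENNReal.ofReal_ne_top ENNReal.ofReal_ne_top) (hw m))
    exact h1
  choose F hFA hF using hcov
  have hH : Measure.hausdorffMeasure ((n - 1 : ℕ) : ℝ) A = 0 := by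
    have hr : Tendsto (fun m => ENNReal.ofReal (2 * t (j m))) atTop (𝓝 0) := by
      rw [← ENNReal.ofReal_zero]
      refine (ENNReal.continuous_ofReal.tendsto _).comp ?_
      simpa using hjt.const_mul 2
    have hdiam : ∀ m (i : F m), Metric.ediam (Metric.closedBall (i : Rn n) (t (j m)))
        ≤ ENNReal.ofReal (2 * t (j m)) := fun m i => by
      rw [ENNReal.ofReal_mul (by norm_num), ← Metric.closedEBall_ofReal (ht _).le]
      simpa using Metric.ediam_closedEBall_le (x := (i : Rn n)) (r := ENNReal.ofReal (t (j m)))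
    have h1 := Measure.hausdorffMeasure_le_liminf_sum ((n - 1 : ℕ) : ℝ) A
      (fun m => ENNReal.ofReal (2 * t (j m))) hr
      (fun m (i : F m) => Metric.closedBall (i : Rn n) (t (j m)))
      (Eventually.of_forall hdiam) (Eventually.of_forall hFA)
    refine le_zero_iff.1 (h1.trans ?_)
    have h2 : ∀ m, ∑ i : F m, Metric.ediam (Metric.closedBall (i : Rn n) (t (j m)))
        ^ ((n - 1 : ℕ) : ℝ) ≤ ENNReal.ofReal (4 ^ n) * ENNReal.ofReal (1 / ((m : ℝ) + 1)) / ω := by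
      intro m
      have htj := ht (j m)
      refine (Finset.sum_le_sum fun i _ => ENNReal.rpow_le_rpow (hdiam m i) (by positivity)).trans ?_
      rw [Finset.sum_const, nsmul_eq_mul, Finset.card_univ, Fintype.card_coe, ENNReal.rpow_natCast,
        ← ENNReal.ofReal_pow (by positivity), ENNReal.le_div_iff_mul_le (Or.inl hω0) (Or.inl hωt)]
      have h3 := (hF m).trans (mul_le_mul_right (hw m) 2)
      have h4 := mul_le_mul_right h3 (ENNReal.ofReal (4 ^ n))
      -- The factor `4 ^ n` turns the packing radius `t / 2` into the diameter `2 t`. One power of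
      -- `2 t` is then split off, to be cancelled against the `t` in the `o(t)` volume bound.
      have e1 : (4 : ℝ) ^ n * (t (j m) / 2) ^ n = (2 * t (j m)) ^ (n - 1) * (2 * t (j m)) := by
        rw [← pow_succ, Nat.sub_add_cancel (Nat.one_le_iff_ne_zero.2 (NeZero.ne n)), ← mul_pow]
        ring
      have e2 : ENNReal.ofReal (4 ^ n) * ((F m).card * (ENNReal.ofReal ((t (j m) / 2) ^ n) * ω))
          = (F m).card * ENNReal.ofReal ((2 * t (j m)) ^ (n - 1)) * ω
            * ENNReal.ofReal (2 * t (j m)) := by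
        have := congrArg ENNReal.ofReal e1
        rw [ENNReal.ofReal_mul (by positivity), ENNReal.ofReal_mul (by positivity)] at this
        calc _ = (F m).card * ω * (ENNReal.ofReal (4 ^ n) * ENNReal.ofReal ((t (j m) / 2) ^ n)) := by
              ring
          _ = _ := by rw [this]; ring
      have e3 : ENNReal.ofReal (4 ^ n) * (2 * (ENNReal.ofReal (1 / ((m : ℝ) + 1))
          * ENNReal.ofReal (t (j m)))) = ENNReal.ofReal (4 ^ n) * ENNReal.ofReal (1 / ((m : ℝ) + 1))
            * ENNReal.ofReal (2 * t (j m)) := by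
        rw [ENNReal.ofReal_mul (p := 2) (by norm_num), ENNReal.ofReal_ofNat]
        ring
      rw [e2, e3] at h4
      exact (ENNReal.mul_le_mul_iff_left (by simpa using htj) ENNReal.ofReal_ne_top).1 h4
    have h3 : Tendsto (fun m : ℕ => ENNReal.ofReal (4 ^ n) * ENNReal.ofReal (1 / ((m : ℝ) + 1)) / ω)
        atTop (𝓝 0) := by
      have h4 : Tendsto (fun m : ℕ => ENNReal.ofReal (1 / ((m : ℝ) + 1))) atTop (𝓝 0) := by
        rw [← ENNReal.ofReal_zero]
        exact (ENNReal.continuous_ofReal.tendsto _).comp tendsto_one_div_add_atTop_nhds_zero_nat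
      have h5 := ENNReal.Tendsto.div_const
        (ENNReal.Tendsto.const_mul (a := ENNReal.ofReal (4 ^ n)) h4
          (Or.inr ENNReal.ofReal_ne_top)) (Or.inr hω0)
      simpa using h5
    rw [← h3.liminf_eq]
    exact liminf_le_liminf (Eventually.of_forall h2)
  rw [Measure.euclideanHausdorffMeasure_def, Measure.smul_apply, hH, smul_zero]

end Hausdorff

/-! ### The maximizer on the boundary of its domain. -/

section EssentialContinuity

variable {n : ℕ} {μ : Measure (Rn n)} {ψ : Rn n → ℝ} {S : Set (Rn n)} {β : ℝ}

/-- Adding `t ‖y‖` to `ψ` lets every finite value of `f` spread over distance `t`, in particular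
beyond the domain. -/
theorem supAffine_add_norm_le {t : ℝ} {x z : Rn n} (h : dist x z ≤ t) :
    supAffine (fun y => ψ y + t * ‖y‖) S x ≤ supAffine ψ S z := by
  refine iSup₂_mono fun y _ => ENNReal.ofReal_le_ofReal ?_
  have h1 : inner ℝ (x - z) y ≤ t * ‖y‖ := by
    refine (real_inner_le_norm _ _).trans ?_
    rw [← dist_eq_norm]
    gcongr
  rw [inner_sub_left] at h1
  linarith

/-- A maximizer is infinite almost everywhere on the boundary of its domain. -/
theorem hausdorffMeasure_frontier_domain_eq_zero [NeZero n] (hβ : (n : ℝ) < β)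
    [IsProbabilityMeasure μ] (hmoment : Integrable (fun x : Rn n => ‖x‖) μ)
    (hmax : ∀ ψ' S', Admissible μ ψ' S' →
      negPowInt β (supAffine ψ' S') ≤ negPowInt β (supAffine ψ S))
    (hadm : Admissible μ ψ S) (htop : negPowInt β (supAffine ψ S) ≠ ⊤)
    (hone : ∀ x, 1 ≤ supAffine ψ S x) (hI : ∫ y, ψ y ∂μ = -1) :
    (Measure.euclideanHausdorffMeasure (n - 1) : Measure (Rn n))
      (frontier (closure {x | supAffine ψ S x < ⊤}) ∩ {x | supAffine ψ S x < ⊤}) = 0 := by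
  set K := closure {x | supAffine ψ S x < ⊤} with hK
  have hβ0 : 0 < β := (Nat.cast_nonneg n).trans_lt hβ
  have hconv : Convex ℝ K := (convexOn_toReal_supAffine (ψ := ψ) (S := S)).1.closure
  have hunion : frontier K ∩ {x | supAffine ψ S x < ⊤}
      ⊆ ⋃ k : ℕ, frontier K ∩ {x | supAffine ψ S x ≤ (k + 1 : ℕ)} := by
    rintro x ⟨hx, hlt⟩
    obtain ⟨k, hk⟩ := ENNReal.exists_nat_gt hlt.ne
    exact mem_iUnion.2 ⟨k, hx, hk.le.trans (by exact_mod_cast Nat.le_succ k)⟩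
  refine measure_mono_null hunion (measure_iUnion_null fun k => ?_)
  set A := frontier K ∩ {x | supAffine ψ S x ≤ (k + 1 : ℕ)} with hA
  set b : ℝ≥0∞ := ((k + 1 : ℕ) : ℝ≥0∞) ^ (-β) with hb
  have hb0 : b ≠ 0 := by
    rw [hb, ENNReal.rpow_neg]
    exact ENNReal.inv_ne_zero.2 (ENNReal.rpow_ne_top_of_nonneg hβ0.le (ENNReal.natCast_ne_top _))
  set t : ℕ → ℝ := fun j => 1 / ((j : ℝ) + 1) with ht
  have htpos : ∀ j, 0 < t j := fun j => by positivity
  have ht0 : Tendsto t atTop (𝓝 0) := tendsto_one_div_add_atTop_nhds_zero_nat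
  refine hausdorffMeasure_frontier_eq_zero hconv isClosed_closure inter_subset_left htpos ht0 ?_
  -- Within distance `t j` of `A` the perturbed function is at most `k + 1`, and outside `K` the
  -- function `f` is infinite; so the boundary term dominates `b` times the outer volume.
  have h1 : ∀ j, b * (volume (Metric.thickening (t j) A \ K) / ENNReal.ofReal (t j)) ≤
      (∫⁻ x in {x | supAffine ψ S x = ⊤},
        supAffine (fun y => ψ y + t j * ‖y‖) S x ^ (-β)) / ENNReal.ofReal (t j) := by
    intro j
    rw [← mul_div_assoc]
    gcongr
    rw [← setLIntegral_const]
    refine le_trans (setLIntegral_mono_ae'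
      (Metric.isOpen_thickening.measurableSet.diff isClosed_closure.measurableSet)
      (Eventually.of_forall fun x hx => ?_)) (lintegral_mono_set fun x hx => ?_)
    · obtain ⟨z, hz, hxz⟩ := Metric.mem_thickening_iff.1 hx.1
      exact rpow_neg_anti hβ0.le ((supAffine_add_norm_le hxz.le).trans hz.2)
    · by_contra h
      exact hx.2 (subset_closure (lt_top_iff_ne_top.2 h))
  have h2 := liminf_le_liminf (f := atTop) (Eventually.of_forall h1)
  rw [liminf_outside_eq_zero hβ hmoment hmax hadm htop hone hI htpos ht0] at h2
  have h3 : b * liminf (fun j => volume (Metric.thickening (t j) A \ K) / ENNReal.ofReal (t j))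
      atTop ≤ 0 := by
    refine le_trans (le_trans (le_of_eq ?_) (ENNReal.le_liminf_mul (u := fun _ => b))) h2
    rw [liminf_const]
  exact (mul_eq_zero.1 (le_zero_iff.1 h3)).resolve_left hb0

end EssentialContinuity

/-! ### The rescaled potential. -/

section Potential

variable {n : ℕ}

/-- The rescaled potential `c f(x / c) - β`. -/
noncomputable def scaledPotential (f : Rn n → ℝ≥0∞) (c β : ℝ) (x : Rn n) : EReal :=
  ((ENNReal.ofReal c * f (c⁻¹ • x) : ℝ≥0∞) : EReal) - (β : EReal)

theorem scaledPotential_eq_top {f : Rn n → ℝ≥0∞} {c β : ℝ} (hc : 0 < c) {x : Rn n}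
    (hx : f (c⁻¹ • x) = ⊤) : scaledPotential f c β x = ⊤ := by
  rw [scaledPotential, hx, ENNReal.mul_top (by simpa using hc), EReal.coe_ennreal_top,
    EReal.top_sub_coe]

theorem scaledPotential_eq_coe {f : Rn n → ℝ≥0∞} {c β : ℝ} (hc : 0 < c) {x : Rn n}
    (hx : f (c⁻¹ • x) ≠ ⊤) :
    scaledPotential f c β x = ((c * (f (c⁻¹ • x)).toReal - β : ℝ) : EReal) := by
  rw [scaledPotential, EReal.coe_sub, ← EReal.coe_ennreal_toReal
    (ENNReal.mul_ne_top ENNReal.ofReal_ne_top hx), ENNReal.toReal_mul, ENNReal.toReal_ofReal hc.le]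

theorem scaledPotential_lt_top_iff {f : Rn n → ℝ≥0∞} {c β : ℝ} (hc : 0 < c) {x : Rn n} :
    scaledPotential f c β x < ⊤ ↔ f (c⁻¹ • x) ≠ ⊤ := by
  by_cases hx : f (c⁻¹ • x) = ⊤
  · simp [scaledPotential_eq_top hc hx, hx]
  · rw [scaledPotential_eq_coe hc hx]
    exact iff_of_true (EReal.coe_lt_top _) hx

theorem scaledPotential_ne_bot {f : Rn n → ℝ≥0∞} {c β : ℝ} (hc : 0 < c) (x : Rn n) :
    scaledPotential f c β x ≠ ⊥ := by
  by_cases hx : f (c⁻¹ • x) = ⊤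
  · simp [scaledPotential_eq_top hc hx]
  · rw [scaledPotential_eq_coe hc hx]; exact EReal.coe_ne_bot _

theorem neg_le_scaledPotential (f : Rn n → ℝ≥0∞) {c : ℝ} (hc : 0 < c) (β : ℝ) (x : Rn n) :
    ((-β : ℝ) : EReal) ≤ scaledPotential f c β x := by
  by_cases hx : f (c⁻¹ • x) = ⊤
  · simp [scaledPotential_eq_top hc hx]
  · rw [scaledPotential_eq_coe hc hx, EReal.coe_le_coe_iff]
    have : 0 ≤ c * (f (c⁻¹ • x)).toReal := by positivity
    linarith

/-- With `c = β s` and `α = -1 / β`, the additive constant cancels: `1 - α (c f - β) = s f`. -/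
theorem alphaDensity_scaledPotential (f : Rn n → ℝ≥0∞) {α s β : ℝ} (hβ : 0 < β) (hs : 0 < s)
    (hα : α = -1 / β) (x : Rn n) :
    alphaDensity α (scaledPotential f (β * s) β) x
      = (ENNReal.ofReal s * f ((β * s)⁻¹ • x)) ^ (-β) := by
  have hα0 : α < 0 := by rw [hα]; exact div_neg_of_neg_of_pos (by norm_num) hβ
  have hc : 0 < β * s := by positivity
  have e : 1 / α = -β := by rw [hα]; field_simp
  rw [alphaDensity, e]
  congr 1
  by_cases hx : f ((β * s)⁻¹ • x) = ⊤
  · rw [scaledPotential_eq_top hc hx, hx, ENNReal.mul_top (by simpa using hs),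
      EReal.coe_mul_top_of_neg hα0, ← EReal.coe_one, EReal.coe_sub_bot, EReal.toENNReal_top]
  · rw [scaledPotential_eq_coe hc hx, ← EReal.coe_mul, ← EReal.coe_one, ← EReal.coe_sub,
      EReal.toENNReal_of_ne_top (EReal.coe_ne_top _), EReal.toReal_coe]
    conv_rhs => rw [← ENNReal.ofReal_toReal hx, ← ENNReal.ofReal_mul hs.le]
    congr 1
    rw [hα]; field_simp; ring

/-- Each inequality is a closed condition by lower semicontinuity, and properness makes the domain
condition automatic. Closedness turns almost sure membership into containment of the support. -/
theorem IsConv.isClosed_subgradGraph {φ : Rn n → EReal} (h : IsConv φ) :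
    IsClosed (subgradGraph φ) := by
  obtain ⟨z₀, hz₀⟩ := h.proper
  have e : subgradGraph φ = ⋂ z : Rn n,
      {p : Rn n × Rn n | φ p.1 + ((inner ℝ p.2 (z - p.1) : ℝ) : EReal) ≤ φ z} := by
    ext p
    simp only [subgradGraph, mem_ofPred_eq, mem_iInter, and_iff_right_iff_imp]
    intro hp
    by_contra htop
    have h1 : φ p.1 = ⊤ := not_lt_top_iff.1 htop
    have h2 := hp z₀
    rw [h1, EReal.top_add_coe] at h2
    exact absurd hz₀ (not_lt.2 h2)
  rw [e]
  refine isClosed_iInter fun z => ?_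
  by_cases hz : φ z = ⊤
  · simp [hz]
  have hzr : φ z = ((φ z).toReal : EReal) := (EReal.coe_toReal hz (h.ne_bot z)).symm
  have e2 : {p : Rn n × Rn n | φ p.1 + ((inner ℝ p.2 (z - p.1) : ℝ) : EReal) ≤ φ z}
      = (fun p : Rn n × Rn n => (p.1, (((φ z).toReal - inner ℝ p.2 (z - p.1) : ℝ) : EReal))) ⁻¹'
        {q : Rn n × EReal | φ q.1 ≤ q.2} := by
    ext p
    simp only [mem_ofPred_eq, mem_preimage]
    rw [EReal.coe_sub, ← hzr, EReal.le_sub_iff_add_le (Or.inl (EReal.coe_ne_bot _))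
      (Or.inl (EReal.coe_ne_top _))]
  rw [e2]
  refine h.lsc.isClosed_epigraph.preimage ?_
  exact continuous_fst.prodMk (continuous_coe_real_ereal.comp (by fun_prop))

theorem isConv_scaledPotential {ψ : Rn n → ℝ} {S : Set (Rn n)} {c : ℝ} (hc : 0 < c) (β : ℝ)
    {x₀ : Rn n} (hx₀ : supAffine ψ S x₀ ≠ ⊤) : IsConv (scaledPotential (supAffine ψ S) c β) where
  ne_bot := scaledPotential_ne_bot hc
  proper := ⟨c • x₀, (scaledPotential_lt_top_iff hc).2 (by rwa [inv_smul_smul₀ hc.ne'])⟩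
  convex := by
    intro x y t ht
    -- The endpoints are separated because `0 * ⊤ = 0`; for positive weights an infinite value makes
    -- the right-hand side infinite.
    rcases eq_or_lt_of_le ht.1 with rfl | ht0
    · simp
    rcases eq_or_lt_of_le ht.2 with rfl | ht1
    · simp
    have ht1' : 0 < 1 - t := by linarith
    by_cases hx : supAffine ψ S (c⁻¹ • x) = ⊤
    · rw [scaledPotential_eq_top hc hx, EReal.coe_mul_top_of_pos ht0, EReal.top_add_of_ne_bot]
      · exact le_top
      · by_cases hy : supAffine ψ S (c⁻¹ • y) = ⊤
        · rw [scaledPotential_eq_top hc hy, EReal.coe_mul_top_of_pos ht1']; simp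
        · rw [scaledPotential_eq_coe hc hy, ← EReal.coe_mul]; exact EReal.coe_ne_bot _
    by_cases hy : supAffine ψ S (c⁻¹ • y) = ⊤
    · rw [scaledPotential_eq_top hc hy, EReal.coe_mul_top_of_pos ht1', EReal.add_top_of_ne_bot]
      · exact le_top
      · rw [scaledPotential_eq_coe hc hx, ← EReal.coe_mul]; exact EReal.coe_ne_bot _
    have hconv := convexOn_toReal_supAffine (ψ := ψ) (S := S)
    have hx' : c⁻¹ • x ∈ {x | supAffine ψ S x < ⊤} := lt_top_iff_ne_top.2 hx
    have hy' : c⁻¹ • y ∈ {x | supAffine ψ S x < ⊤} := lt_top_iff_ne_top.2 hy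
    have e : c⁻¹ • (t • x + (1 - t) • y) = t • (c⁻¹ • x) + (1 - t) • (c⁻¹ • y) := by
      rw [smul_add, smul_comm c⁻¹ t, smul_comm c⁻¹ (1 - t)]
    have hxy := hconv.1 hx' hy' ht0.le ht1'.le (by ring)
    have h1 := hconv.2 hx' hy' ht0.le ht1'.le (by ring)
    rw [← e] at hxy h1
    rw [scaledPotential_eq_coe hc hx, scaledPotential_eq_coe hc hy,
      scaledPotential_eq_coe hc (ne_of_lt hxy), ← EReal.coe_mul, ← EReal.coe_mul, ← EReal.coe_add,
      EReal.coe_le_coe_iff]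
    simp only [smul_eq_mul] at h1
    nlinarith
  lsc := by
    have hcont : Continuous fun a : ℝ≥0∞ => ((ENNReal.ofReal c * a : ℝ≥0∞) : EReal) - (β : EReal) := by
      refine continuous_iff_continuousAt.2 fun a => ?_
      simp only [sub_eq_add_neg, ← EReal.coe_neg]
      refine ContinuousAt.comp (f := fun a : ℝ≥0∞ =>
        (((ENNReal.ofReal c * a : ℝ≥0∞) : EReal), ((-β : ℝ) : EReal)))
        (EReal.continuousAt_add (Or.inr (EReal.coe_ne_bot _)) (Or.inr (EReal.coe_ne_top _))) ?_
      exact ((continuous_coe_ennreal_ereal.comp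
        (ENNReal.continuous_const_mul ENNReal.ofReal_ne_top)).prodMk continuous_const).continuousAt
    have hmono : Monotone fun a : ℝ≥0∞ =>
        ((ENNReal.ofReal c * a : ℝ≥0∞) : EReal) - (β : EReal) := fun a b hab =>
      EReal.sub_le_sub (EReal.coe_ennreal_le_coe_ennreal_iff.2 (by gcongr)) le_rfl
    exact hcont.comp_lowerSemicontinuous
      (lowerSemicontinuous_supAffine.comp (continuous_const_smul c⁻¹)) hmono

end Potential

/-! ### The measure built from the maximizer. -/

section Assembly

variable {n : ℕ}

theorem frontier_closure_domain_smul (f : Rn n → ℝ≥0∞) {c : ℝ} (hc : c ≠ 0) :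
    frontier (closure {x | f (c⁻¹ • x) < ⊤}) ∩ {x | f (c⁻¹ • x) < ⊤}
      = (fun x : Rn n => c⁻¹ • x) ⁻¹' (frontier (closure {x | f x < ⊤}) ∩ {x | f x < ⊤}) := by
  have e := (Homeomorph.smulOfNeZero c⁻¹ (inv_ne_zero hc) : Rn n ≃ₜ Rn n).preimage_closure
    {x | f x < ⊤}
  have e2 := (Homeomorph.smulOfNeZero c⁻¹ (inv_ne_zero hc) : Rn n ≃ₜ Rn n).preimage_frontier
    (closure {x | f x < ⊤})
  refine Eq.trans ?_ (congrArg (· ∩ {x | f (c⁻¹ • x) < ⊤}) (e2.trans (congrArg frontier e))).symm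
  rfl

theorem withDensity_comp_inv_smul {c : ℝ} (hc : 0 < c) {w : Rn n → ℝ≥0∞} (hw : Measurable w) :
    (volume : Measure (Rn n)).withDensity (fun x => w (c⁻¹ • x))
      = ENNReal.ofReal (c ^ n) • ((volume : Measure (Rn n)).withDensity w).map (fun x => c • x) := by
  ext B hB
  rw [withDensity_apply _ hB, Measure.smul_apply, Measure.map_apply (measurable_const_smul c) hB,
    withDensity_apply _ (measurable_const_smul c hB), ← lintegral_indicator hB,
    ← lintegral_indicator (measurable_const_smul c hB), smul_eq_mul]
  have h1 := lintegral_comp_smul_pos (inv_pos.2 hc)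
    (hw.indicator (measurable_const_smul c hB))
  rw [inv_pow, inv_inv] at h1
  rw [← h1]
  refine lintegral_congr fun x => ?_
  have h2 : c⁻¹ • x ∈ (fun x => c • x) ⁻¹' B ↔ x ∈ B := by
    rw [mem_preimage, smul_inv_smul₀ hc.ne']
  by_cases hx : x ∈ B
  · rw [indicator_of_mem hx, indicator_of_mem (h2.2 hx)]
  · rw [indicator_of_notMem hx, indicator_of_notMem (mt h2.1 hx)]

variable {μ : Measure (Rn n)} {ψ : Rn n → ℝ} {S : Set (Rn n)} {α β s : ℝ}

/-- The `α`-concave measure without singular part given by a rescaled supremum of affine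
functions. -/
noncomputable def scaledMeasure (ψ : Rn n → ℝ) (S : Set (Rn n)) (hβ : 0 < β) (hs : 0 < s)
    (hα : α = -1 / β) {x₀ : Rn n} (hx₀ : supAffine ψ S x₀ ≠ ⊤) : AlphaConcaveMeasure n α where
  base := scaledPotential (supAffine ψ S) (β * s) β
  sing := 0
  isConv_base := isConv_scaledPotential (by positivity) β hx₀
  le_base := fun x => by
    have e : 1 / α = -β := by rw [hα]; field_simp
    rw [e]
    exact neg_le_scaledPotential _ (by positivity) β x
  mutuallySingular := Measure.MutuallySingular.zero_left
  sing_concentrated := by simp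

variable (hβ : 0 < β) (hs : 0 < s) (hα : α = -1 / β) {x₀ : Rn n} (hx₀ : supAffine ψ S x₀ ≠ ⊤)

theorem scaledMeasure_density (x : Rn n) : (scaledMeasure ψ S hβ hs hα hx₀).density x
    = ENNReal.ofReal (s ^ (-β)) * supAffine ψ S ((β * s)⁻¹ • x) ^ (-β) := by
  rw [← ofReal_mul_rpow_neg hs hβ.le]
  exact alphaDensity_scaledPotential _ hβ hs hα x

theorem lintegral_scaledMeasure_density : ∫⁻ x, (scaledMeasure ψ S hβ hs hα hx₀).density x
    = ENNReal.ofReal (s ^ (-β)) * (ENNReal.ofReal ((β * s) ^ n) * negPowInt β (supAffine ψ S)) := by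
  simp only [scaledMeasure_density]
  rw [lintegral_const_mul' _ _ ENNReal.ofReal_ne_top,
    lintegral_comp_smul_pos (g := fun x => supAffine ψ S x ^ (-β)) (by positivity)
      (measurable_supAffine.pow_const _), inv_pow, inv_inv, negPowInt]

theorem scaledMeasure_weighted : (scaledMeasure ψ S hβ hs hα hx₀).weighted
    = (ENNReal.ofReal (s ^ (-β - 1)) * ENNReal.ofReal ((β * s) ^ n)) •
      (volume.withDensity fun x => supAffine ψ S x ^ (-β - 1)).map (fun x => (β * s) • x) := by
  have hc : 0 < β * s := by positivity
  have e : ∀ x, (scaledMeasure ψ S hβ hs hα hx₀).density x ^ (1 - α)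
      = ENNReal.ofReal (s ^ (-β - 1)) * supAffine ψ S ((β * s)⁻¹ • x) ^ (-β - 1) := by
    intro x
    have h1 := alphaDensity_scaledPotential (supAffine ψ S) hβ hs hα x
    change (alphaDensity α (scaledPotential (supAffine ψ S) (β * s) β) x) ^ (1 - α) = _
    have h2 : -β * (1 - α) = -(β + 1) := by rw [hα]; field_simp; ring
    rw [h1, ← ENNReal.rpow_mul, h2, ofReal_mul_rpow_neg hs (by positivity),
      show -(β + 1) = -β - 1 by ring]
  have h3 : (scaledMeasure ψ S hβ hs hα hx₀).weighted = volume.withDensity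
      (fun x => ENNReal.ofReal (s ^ (-β - 1)) * supAffine ψ S ((β * s)⁻¹ • x) ^ (-β - 1)) := by
    rw [← funext e]
    exact add_zero _
  rw [h3]
  have h4 := withDensity_smul (μ := (volume : Measure (Rn n))) (ENNReal.ofReal (s ^ (-β - 1)))
    (f := fun x => supAffine ψ S ((β * s)⁻¹ • x) ^ (-β - 1))
    ((measurable_supAffine.comp (measurable_const_smul _)).pow_const _)
  refine h4.trans ?_
  rw [withDensity_comp_inv_smul hc (w := fun x => supAffine ψ S x ^ (-β - 1))
    (measurable_supAffine.pow_const _), smul_smul]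

/-- The dilation `c f(x / c)` moves base points but not gradients, so the slope at `c • x` is still
`gradSup ψ S x`. Points where `f` is infinite carry no mass. -/
theorem ae_mem_subgradGraph (hβ : 0 < β) (hone : ∀ x, 1 ≤ supAffine ψ S x) {c : ℝ} (hc : 0 < c) :
    ∀ᵐ x ∂((volume : Measure (Rn n)).withDensity fun x => supAffine ψ S x ^ (-β - 1)),
      (c • x, gradSup ψ S x) ∈ subgradGraph (scaledPotential (supAffine ψ S) c β) := by
  rw [ae_withDensity_iff (measurable_supAffine.pow_const _)]
  filter_upwards [ae_top_or_differentiableAt ψ S] with x hx hne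
  rcases hx with hx | ⟨hx, hd⟩
  · exact absurd (by rw [hx, ENNReal.top_rpow_of_neg (by linarith)]) hne
  have hfin : supAffine ψ S (c⁻¹ • c • x) ≠ ⊤ := by
    rw [inv_smul_smul₀ hc.ne']; exact (interior_subset hx).ne
  refine ⟨(scaledPotential_lt_top_iff hc).2 hfin, fun z => ?_⟩
  by_cases hz : supAffine ψ S (c⁻¹ • z) = ⊤
  · rw [scaledPotential_eq_top hc hz]; exact le_top
  simp only
  rw [scaledPotential_eq_coe hc hz, scaledPotential_eq_coe hc hfin, ← EReal.coe_add,
    EReal.coe_le_coe_iff, inv_smul_smul₀ hc.ne']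
  have h1 := supAffine_ge_gradient (hone x) hx hd hz
  change _ + inner ℝ (gradSup ψ S x) (c⁻¹ • z - x) ≤ _ at h1
  have e : inner ℝ (gradSup ψ S x) (z - c • x) = c * inner ℝ (gradSup ψ S x) (c⁻¹ • z - x) := by
    rw [← inner_smul_right, smul_sub, smul_inv_smul₀ hc.ne']
  rw [e]
  nlinarith

theorem scaledMeasure_isEuclideanSurfaceAreaMeasure (hone : ∀ x, 1 ≤ supAffine ψ S x)
    (hmap : (ENNReal.ofReal (s ^ (-β - 1)) * ENNReal.ofReal ((β * s) ^ n)) •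
      (volume.withDensity fun x => supAffine ψ S x ^ (-β - 1)).map (gradSup ψ S) = μ) :
    (scaledMeasure ψ S hβ hs hα hx₀).IsEuclideanSurfaceAreaMeasure μ := by
  have hc : 0 < β * s := by positivity
  have hm : Measurable fun x : Rn n => ((β * s) • x, gradSup ψ S x) :=
    (measurable_const_smul _).prodMk measurable_gradSup
  refine ⟨(ENNReal.ofReal (s ^ (-β - 1)) * ENNReal.ofReal ((β * s) ^ n)) •
    (volume.withDensity fun x => supAffine ψ S x ^ (-β - 1)).map
      (fun x => ((β * s) • x, gradSup ψ S x)), ?_, ?_, ?_⟩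
  · rw [scaledMeasure_weighted, Measure.map_smul, Measure.map_map measurable_fst hm]
    rfl
  · rw [Measure.map_smul, Measure.map_map measurable_snd hm]
    exact hmap
  · refine Measure.support_subset_of_isClosed
      (scaledMeasure ψ S hβ hs hα hx₀).isConv_base.isClosed_subgradGraph ?_
    refine Measure.ae_smul_measure ?_ _
    exact (ae_map_iff hm.aemeasurable
      (scaledMeasure ψ S hβ hs hα hx₀).isConv_base.isClosed_subgradGraph.measurableSet).2
      (ae_mem_subgradGraph hβ hone hc)

theorem scaledMeasure_sphericalSurfaceAreaMeasure [NeZero n]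
    (hzero : (Measure.euclideanHausdorffMeasure (n - 1) : Measure (Rn n))
      (frontier (closure {x | supAffine ψ S x < ⊤}) ∩ {x | supAffine ψ S x < ⊤}) = 0) :
    (scaledMeasure ψ S hβ hs hα hx₀).sphericalSurfaceAreaMeasure = 0 := by
  have hc : 0 < β * s := by positivity
  have hset : {x | (scaledMeasure ψ S hβ hs hα hx₀).density x ≠ 0}
      = {x | supAffine ψ S ((β * s)⁻¹ • x) < ⊤} := by
    ext x
    simp only [mem_ofPred_eq, scaledMeasure_density, ne_eq, mul_eq_zero, not_or,
      ENNReal.ofReal_eq_zero, not_le, lt_top_iff_ne_top]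
    rw [ENNReal.rpow_neg, ENNReal.inv_eq_zero, ENNReal.rpow_eq_top_iff_of_pos hβ]
    exact and_iff_right (Real.rpow_pos_of_pos hs _)
  have hnull : (Measure.euclideanHausdorffMeasure (n - 1) : Measure (Rn n))
      (frontier (scaledMeasure ψ S hβ hs hα hx₀).supp
        ∩ {x | (scaledMeasure ψ S hβ hs hα hx₀).density x ≠ 0}) = 0 := by
    rw [AlphaConcaveMeasure.supp, hset, frontier_closure_domain_smul _ hc.ne',
      preimage_smul_inv₀ hc.ne', Measure.euclideanHausdorffMeasure_smul₀ _ hc.ne', hzero, smul_zero]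
  rw [AlphaConcaveMeasure.sphericalSurfaceAreaMeasure]
  -- The density vanishes almost everywhere on the boundary, so the push-forward is zero whatever
  -- the Gauss map is.
  have h1 : (scaledMeasure ψ S hβ hs hα hx₀).density =ᵐ[(Measure.euclideanHausdorffMeasure (n - 1) :
      Measure (Rn n)).restrict (frontier (scaledMeasure ψ S hβ hs hα hx₀).supp)] 0 := by
    rw [Filter.EventuallyEq, ae_restrict_iff' isClosed_frontier.measurableSet]
    refine measure_mono_null (fun x hx => ?_) hnull
    simpa using hx
  rw [withDensity_congr_ae h1, withDensity_zero, Measure.map_zero]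

end Assembly

theorem mainTheorem3 (n : ℕ) [NeZero n] (α : ℝ) (hα : -(1 / (n : ℝ)) < α) (hα0 : α < 0)
    (μ : Measure (Rn n)) [IsProbabilityMeasure μ]
    (hmoment : Integrable (fun x : Rn n => ‖x‖) μ)
    (hbary : ∫ x, x ∂μ = 0)
    (hplane : ∀ (v : Rn n) (c : ℝ), v ≠ 0 → ¬ μ.support ⊆ {x : Rn n | inner ℝ v x = c}) :
    ∃ r : AlphaConcaveMeasure n α,
      IsFiniteMeasure r.toMeasure ∧
      0 < ∫⁻ x, r.density x ∧
      r.IsEuclideanSurfaceAreaMeasure μ ∧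
      r.sphericalSurfaceAreaMeasure = 0 := by
  have hn : (0 : ℝ) < n := Nat.cast_pos.2 (Nat.pos_of_ne_zero (NeZero.ne n))
  obtain ⟨β, hβα⟩ : ∃ β : ℝ, β = -1 / α := ⟨_, rfl⟩
  have hβ : (n : ℝ) < β := by
    rw [hβα, lt_div_iff_of_neg hα0]
    have := mul_lt_mul_of_pos_right hα hn
    rw [neg_mul, one_div_mul_cancel hn.ne'] at this
    linarith
  have hβ0 : 0 < β := hn.trans hβ
  have hαβ : α = -1 / β := by
    have := hα0.ne
    rw [hβα]; field_simp
  obtain ⟨ψ, S, hadm, hmax, h0, htop⟩ := exists_maximizer hmoment hbary hplane hβ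
  have hone := hadm.one_le hmoment hbary
  have hI := integral_eq_of_maximizer hβ hmax hadm h0 htop
  obtain ⟨x₀, hx₀⟩ : ∃ x₀, supAffine ψ S x₀ ≠ ⊤ := by
    by_contra! h
    exact h0 (by simp [negPowInt, h, hβ0])
  set C := negPowInt β (supAffine ψ S) * ENNReal.ofReal (β - n) / ENNReal.ofReal β with hC
  have hC0 : C ≠ 0 := ENNReal.div_ne_zero.2 ⟨mul_ne_zero h0 (by simpa using hβ),
    ENNReal.ofReal_ne_top⟩
  have hCtop : C ≠ ⊤ := ENNReal.div_ne_top (ENNReal.mul_ne_top htop ENNReal.ofReal_ne_top)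
    (by simpa using hβ0)
  have hCr : 0 < C.toReal := ENNReal.toReal_pos hC0 hCtop
  -- This solves `s ^ (-β - 1) * (β s) ^ n * C = 1`, which makes the second marginal exactly `μ`;
  -- the exponent `β + 1 - n` is positive.
  set s : ℝ := (β ^ n * C.toReal) ^ (1 / (β + 1 - n)) with hs
  have hs0 : 0 < s := by positivity
  have hspow : s ^ (-β - 1) * (β * s) ^ n * C.toReal = 1 := by
    have h1 : s ^ (β + 1 - n) = β ^ n * C.toReal := by
      rw [hs, ← Real.rpow_mul (by positivity), one_div_mul_cancel (by linarith), Real.rpow_one]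
    have h2 : s ^ (-β - 1) * s ^ n = (s ^ (β + 1 - n))⁻¹ := by
      rw [← Real.rpow_natCast s n, ← Real.rpow_add hs0, ← Real.rpow_neg hs0.le]
      congr 1; ring
    have h3 : 0 < β ^ n * C.toReal := by positivity
    calc s ^ (-β - 1) * (β * s) ^ n * C.toReal
        = (s ^ (-β - 1) * s ^ n) * (β ^ n * C.toReal) := by rw [mul_pow]; ring
      _ = 1 := by rw [h2, h1, inv_mul_cancel₀ h3.ne']
  refine ⟨scaledMeasure ψ S hβ0 hs0 hαβ hx₀, ?_, ?_, ?_, ?_⟩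
  · refine ⟨?_⟩
    have h1 : (scaledMeasure ψ S hβ0 hs0 hαβ hx₀).toMeasure univ
        = ∫⁻ x, (scaledMeasure ψ S hβ0 hs0 hαβ hx₀).density x := by
      have e : (scaledMeasure ψ S hβ0 hs0 hαβ hx₀).toMeasure
          = volume.withDensity (scaledMeasure ψ S hβ0 hs0 hαβ hx₀).density := add_zero _
      rw [e, withDensity_apply _ MeasurableSet.univ, Measure.restrict_univ]
    rw [h1, lintegral_scaledMeasure_density]
    exact ENNReal.mul_lt_top ENNReal.ofReal_lt_top
      (ENNReal.mul_lt_top ENNReal.ofReal_lt_top htop.lt_top)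
  · rw [lintegral_scaledMeasure_density]
    refine ENNReal.mul_pos (ENNReal.ofReal_pos.2 (by positivity)).ne' (mul_ne_zero ?_ h0)
    exact (ENNReal.ofReal_pos.2 (by positivity)).ne'
  · refine scaledMeasure_isEuclideanSurfaceAreaMeasure hβ0 hs0 hαβ hx₀ hone ?_
    rw [map_gradSup_eq hβ hmax hadm htop hone hI, smul_smul, ← hC, ← ENNReal.ofReal_toReal hCtop,
      ← ENNReal.ofReal_mul (by positivity), ← ENNReal.ofReal_mul (by positivity), hspow,
      ENNReal.ofReal_one, one_smul]
  · exact scaledMeasure_sphericalSurfaceAreaMeasure hβ0 hs0 hαβ hx₀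
      (hausdorffMeasure_frontier_domain_eq_zero hβ hmoment hmax hadm htop hone hI)
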